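/- Let $d\ge 2$ and let $((G_n)_{n\in\mathbb N},(\rho_n)_{n\in\mathbb N},(\kappa_k^n)_{k\le n})$ be a $d$-ary cloning system, that is: groups $G_n$, homomorphisms $\rho_n:G_n\to S_n$, and injective maps $\kappa_k^n:G_n\to G_{n+d-1}$ for $1\le k\le n$ (written to the right of their argument) such that 1. $(gh)\kappa_k^n=(g)\kappa^n_{\rho_n(h)k}\,(h)\kappa_k^n$ for $1\le k\le n$ and $g,h\in G_n$; 2. $((g)\kappa_\ell^n)\kappa_k^{n+d-1}=((g)\kappa_k^n)\kappa_{\ell+d-1}^{n+d-1}$ for $1\le k<\ell\le n$ and $g\in G_n$; 3. $\rho_{n+d-1}((g)\kappa_k^n)(i)=((\rho_n(g))\varsigma_k^n)(i)$ for all $1\le k\le n$, $g\in G_n$ and $i\notin\{k,\dots,k+d-1\}$, where $\varsigma_k^n:S_n\to S_{n+d-1}$ replaces the $k$-th arrow in the arrow diagram of a permutation by $d$ parallel arrows. Let $\mathscr T_d(G_*)$ be the associated Thompson-like group. Its elements are the classes $[T,g,U]$, where $T,U$ are finite rooted ordered $d$-ary trees with the same number $n$ of leaves and $g\in G_n$,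 under the equivalence relation generated by $(T,g,U)\sim(T',(g)\kappa_k^n,U')$, where $U'$ (resp. $T'$) is obtained by adding a $d$-ary caret to the $k$-th leaf of $U$ (resp. to the $\rho_n(g)(k)$-th leaf of $T$). The product is determined by $[T,g,U][U,h,W]=[T,gh,W]$. Let $F_d\le\mathscr T_d(G_*)$ be the canonical copy of the Higman--Thompson group, consisting of the elements $[T,1,U]$. For a group $\Gamma$, let $L(\Gamma)\subseteq B(\ell^2(\Gamma))$ be the von Neumann algebra generated by the left regular representation $\lambda$, with trace $\tau(x)=\langle x\delta_1,\delta_1\rangle$ and norm $\|x\|_2=\tau(x^*x)^{1/2}$. Regard $L(F_d)$ as the von Neumann subalgebra of $L(\mathscr T_d(G_*))$ generated by the $\lambda_g$ with $g\in F_d$, and let $E$ be the $\tau$-preserving conditional expectation of $L(\mathscr T_d(G_*))$ onto $L(F_d)$. **Theorem.** Suppose that the cloning system is diverse, i.e. there is $n_0$ such that $\bigcap_{k=1}^n\operatorname{Im}\kappa_k^n=\{1\}$ for all $n\ge n_0$. Then: (a) The inclusion $L(F_d)\subseteq L(\mathscr T_d(G_*))$ has the weak asymptotic homomorphism property: there is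 a net $(u_i)$ of unitaries in $L(F_d)$ such that $\lim_i\|E(xu_iy)-E(x)u_iE(y)\|_2=0$ for all $x,y\in L(\mathscr T_d(G_*))$. (b) The inclusion is weakly mixing: for every finite set $s\subseteq L(\mathscr T_d(G_*))$ with $E(x)=0$ for all $x\in s$ and every $\varepsilon>0$, there is a unitary $v\in L(F_d)$ with $\|E(xvy)\|_2<\varepsilon$ for all $x,y\in s$. (c) $F_d$ has no non-trivial one-sided quasi-normalizers in $\mathscr T_d(G_*)$: if $g,g_1,\dots,g_r\in\mathscr T_d(G_*)$ and $F_dg\subseteq\bigcup_{i=1}^r g_iF_d$, then $g\in F_d$. -/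

import Mathlib

universe u

namespace ThompsonLike

/-! ### Trees -/

/-- Finite rooted `d`-ary trees: every vertex is a leaf or has `d` (ordered) children. -/
inductive DTree (d : ℕ) : Type where
  | leaf : DTree d
  | node (c : Fin d → DTree d) : DTree d

/-- `offset L i` is the sum of the `L j` with `j < i`. -/
def offset {d : ℕ} (L : Fin d → ℕ) (i : Fin d) : ℕ := ∑ j ∈ Finset.Iio i, L j

namespace DTree

variable {d : ℕ}

/-- The number `n(T)` of leaves of `T`. -/
def leaves : DTree d → ℕ
  | leaf => 1
  | node c => ∑ i, (c i).leaves

/-- Add a `d`-ary caret to the leaf number `k` of `T`. The leaves of a tree are numbered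
`0, 1, …, n(T) - 1` from left to right (the function is only used for such `k`). -/
def addCaret : DTree d → ℕ → DTree d
  | leaf, _ => node fun _ => leaf
  | node c, k => node fun i =>
      if offset (fun j => (c j).leaves) i ≤ k ∧
          k < offset (fun j => (c j).leaves) i + (c i).leaves then
        (c i).addCaret (k - offset (fun j => (c j).leaves) i)
      else c i

end DTree

theorem offset_add_le {d : ℕ} (L : Fin d → ℕ) {i j : Fin d} (h : i < j) :
    offset L i + L i ≤ offset L j := by
  unfold offset
  have h1 : i ∉ Finset.Iio i := by simp
  rw [add_comm, ← Finset.sum_insert h1]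
  apply Finset.sum_le_sum_of_subset
  intro x hx
  simp only [Finset.mem_insert, Finset.mem_Iio] at hx ⊢
  rcases hx with rfl | hx
  · exact h
  · exact hx.trans h

theorem offset_unique {d : ℕ} (L : Fin d → ℕ) {i j : Fin d} {k : ℕ}
    (h1 : offset L i ≤ k) (h2 : k < offset L i + L i)
    (h3 : offset L j ≤ k) (h4 : k < offset L j + L j) : i = j := by
  rcases lt_trichotomy i j with h | h | h
  · have := offset_add_le L h; omega
  · exact h
  · have := offset_add_le L h; omega

theorem offset_add_le_sum {d : ℕ} (L : Fin d → ℕ) (i : Fin d) :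
    offset L i + L i ≤ ∑ j, L j := by
  unfold offset
  have h1 : i ∉ Finset.Iio i := by simp
  rw [add_comm, ← Finset.sum_insert h1]
  exact Finset.sum_le_sum_of_subset (Finset.subset_univ _)

theorem exists_child : ∀ {d : ℕ} (L : Fin d → ℕ) {k : ℕ}, k < ∑ i, L i →
    ∃ i, offset L i ≤ k ∧ k < offset L i + L i
  | 0, L, k, h => by simp at h
  | d + 1, L, k, h => by
    rw [Fin.sum_univ_castSucc] at h
    have hoff : ∀ i : Fin d, offset L i.castSucc = offset (fun j => L j.castSucc) i := by
      intro i
      unfold offset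
      rw [← Fin.map_castSuccEmb_Iio, Finset.sum_map]
      rfl
    by_cases hk : k < ∑ i : Fin d, L i.castSucc
    · obtain ⟨i, h1, h2⟩ := exists_child (fun j => L j.castSucc) hk
      exact ⟨i.castSucc, by rw [hoff]; exact h1, by rw [hoff]; exact h2⟩
    · have hl : offset L (Fin.last d) = ∑ i : Fin d, L i.castSucc := by
        unfold offset
        have : Finset.Iio (Fin.last d) = Finset.univ.map Fin.castSuccEmb := by
          ext x
          simp only [Finset.mem_Iio, Finset.mem_map, Finset.mem_univ, true_and]
          constructor
          · intro hx
            exact ⟨x.castPred hx.ne, by simp⟩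
          · rintro ⟨y, rfl⟩
            exact Fin.castSucc_lt_last y
        rw [this, Finset.sum_map]
        rfl
      exact ⟨Fin.last d, by omega, by omega⟩

theorem offset_update {d : ℕ} (L : Fin d → ℕ) (i j : Fin d) (m : ℕ) :
    offset (Function.update L i (L i + m)) j = offset L j + if i < j then m else 0 := by
  unfold offset
  split_ifs with h
  · have hi : i ∈ Finset.Iio j := by simpa using h
    rw [Finset.sum_update_of_mem hi, ← Finset.add_sum_erase _ _ hi, Finset.sdiff_singleton_eq_erase]
    ring
  · rw [Finset.sum_update_of_notMem (by simpa using h), add_zero]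

namespace DTree

variable {d : ℕ}

theorem leaves_update (c : Fin d → DTree d) (i : Fin d) (t : DTree d) :
    (fun j => (Function.update c i t j).leaves) =
      Function.update (fun j => (c j).leaves) i t.leaves := by
  funext j
  by_cases h : j = i
  · subst h; simp
  · simp [h]

theorem addCaret_node (c : Fin d → DTree d) {k : ℕ} {i : Fin d}
    (h1 : offset (fun j => (c j).leaves) i ≤ k)
    (h2 : k < offset (fun j => (c j).leaves) i + (c i).leaves) :
    (node c).addCaret k =
      node (Function.update c i ((c i).addCaret (k - offset (fun j => (c j).leaves) i))) := by
  simp only [addCaret]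
  congr 1
  funext j
  by_cases h : j = i
  · subst h; simp [h1, h2]
  · rw [Function.update_of_ne h, if_neg]
    rintro ⟨h3, h4⟩
    exact h (offset_unique (fun j => (c j).leaves) h3 h4 h1 h2)

theorem leaves_addCaret (hd : 2 ≤ d) (T : DTree d) : ∀ {k : ℕ}, k < T.leaves →
    (T.addCaret k).leaves = T.leaves + (d - 1) := by
  induction T with
  | leaf => intro k _; simp [addCaret, leaves]; omega
  | node c ih =>
    intro k hk
    obtain ⟨i, h1, h2⟩ := exists_child _ hk
    rw [addCaret_node c h1 h2, leaves, leaves, leaves_update, ih i (by omega),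
      Finset.sum_update_of_mem (Finset.mem_univ i),
      ← Finset.add_sum_erase _ _ (Finset.mem_univ i), Finset.sdiff_singleton_eq_erase]
    ring

theorem addCaret_comm (hd : 2 ≤ d) (T : DTree d) : ∀ {k l : ℕ}, k < l → l < T.leaves →
    (T.addCaret l).addCaret k = (T.addCaret k).addCaret (l + (d - 1)) := by
  induction T with
  | leaf => intro k l h1 h2; simp [leaves] at h2; omega
  | node c ih =>
    intro k l hkl hl
    obtain ⟨j, hj1, hj2⟩ := exists_child _ hl
    obtain ⟨i, hi1, hi2⟩ := exists_child _ (hkl.trans hl)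
    rw [addCaret_node c hj1 hj2, addCaret_node c hi1 hi2]
    have eL : ∀ (p : Fin d) (q : ℕ), q < (c p).leaves →
        (fun r => (Function.update c p ((c p).addCaret q) r).leaves) =
          Function.update (fun r => (c r).leaves) p ((c p).leaves + (d - 1)) := by
      intro p q hq
      rw [leaves_update, leaves_addCaret hd _ hq]
    have hj3 : l - offset (fun j => (c j).leaves) j < (c j).leaves := by omega
    have hi3 : k - offset (fun j => (c j).leaves) i < (c i).leaves := by omega
    rcases lt_trichotomy i j with h | h | h
    · have o1 : offset (fun r => (Function.update c j
          ((c j).addCaret (l - offset (fun j => (c j).leaves) j)) r).leaves) i =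
            offset (fun j => (c j).leaves) i := by
        rw [eL j _ hj3, offset_update (fun j => (c j).leaves), if_neg h.not_gt, add_zero]
      have o2 : offset (fun r => (Function.update c i
          ((c i).addCaret (k - offset (fun j => (c j).leaves) i)) r).leaves) j =
            offset (fun j => (c j).leaves) j + (d - 1) := by
        rw [eL i _ hi3, offset_update (fun j => (c j).leaves), if_pos h]
      rw [addCaret_node (i := i) _ (by rw [o1]; exact hi1)
          (by rw [o1, Function.update_of_ne h.ne]; exact hi2),
        addCaret_node (i := j) _ (by rw [o2]; omega)
          (by rw [o2, Function.update_of_ne h.ne']; omega), o1, o2,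
        Function.update_of_ne h.ne, Function.update_of_ne h.ne', Function.update_comm h.ne,
        Nat.add_sub_add_right]
    · subst h
      have o1 : ∀ q, q < (c i).leaves → offset (fun r => (Function.update c i
          ((c i).addCaret q) r).leaves) i = offset (fun j => (c j).leaves) i := by
        intro q hq
        rw [eL i _ hq, offset_update (fun j => (c j).leaves), if_neg (lt_irrefl _), add_zero]
      rw [addCaret_node (i := i) _ (by rw [o1 _ hj3]; exact hi1)
          (by rw [o1 _ hj3, Function.update_self, leaves_addCaret hd _ hj3]; omega),
        addCaret_node (i := i) _ (by rw [o1 _ hi3]; omega)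
          (by rw [o1 _ hi3, Function.update_self, leaves_addCaret hd _ hi3]; omega),
        o1 _ hj3, o1 _ hi3]
      simp only [Function.update_self, Function.update_idem]
      rw [ih i (by omega) hj3]
      congr 4
      omega
    · have := offset_add_le (fun j => (c j).leaves) h
      omega

/-- `S.Le T`: the tree `T` is obtained from `S` by gluing trees to the leaves of `S`. -/
def Le : DTree d → DTree d → Prop
  | leaf, _ => True
  | node _, leaf => False
  | node c, node c' => ∀ i, (c i).Le (c' i)

/-- The union of two trees. -/
def sup : DTree d → DTree d → DTree d
  | leaf, T => T
  | node c, leaf => node c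
  | node c, node c' => node fun i => (c i).sup (c' i)

theorem Le.refl (T : DTree d) : T.Le T := by
  induction T with
  | leaf => trivial
  | node c ih => exact ih

theorem Le.trans {R : DTree d} : ∀ {S T : DTree d}, R.Le S → S.Le T → R.Le T := by
  induction R with
  | leaf => intros; trivial
  | node c ih =>
    rintro (_ | s) (_ | t) h1 h2
    · exact h1.elim
    · exact h1.elim
    · exact h2.elim
    · exact fun i => ih i (h1 i) (h2 i)

theorem le_sup_left (S : DTree d) : ∀ T : DTree d, S.Le (S.sup T) := by
  induction S with
  | leaf => intros; trivial
  | node c ih =>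
    rintro (_ | t)
    · exact Le.refl _
    · exact fun i => ih i (t i)

theorem le_sup_right (S : DTree d) : ∀ T : DTree d, T.Le (S.sup T) := by
  induction S with
  | leaf => intro T; exact Le.refl T
  | node c ih =>
    rintro (_ | t)
    · trivial
    · exact fun i => ih i (t i)

theorem le_addCaret (T : DTree d) : ∀ k : ℕ, T.Le (T.addCaret k) := by
  induction T with
  | leaf => intros; trivial
  | node c ih =>
    intro k i
    dsimp only
    split_ifs
    · exact ih i _
    · exact Le.refl _

theorem leaves_pos (hd : 2 ≤ d) (T : DTree d) : 0 < T.leaves := by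
  induction T with
  | leaf => simp [leaves]
  | node c ih =>
    exact Finset.sum_pos (fun i _ => ih i) ⟨⟨0, by omega⟩, Finset.mem_univ _⟩

theorem Le.leaves_le (hd : 2 ≤ d) {S : DTree d} : ∀ {T : DTree d}, S.Le T →
    S.leaves ≤ T.leaves := by
  induction S with
  | leaf => intro T _; exact T.leaves_pos hd
  | node c ih =>
    rintro (_ | t) h
    · exact h.elim
    · exact Finset.sum_le_sum fun i _ => ih i (h i)

theorem Le.exists_addCaret {S : DTree d} : ∀ {T : DTree d}, S.Le T → S ≠ T →
    ∃ k, k < S.leaves ∧ (S.addCaret k).Le T := by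
  induction S with
  | leaf =>
    rintro (_ | t) h hne
    · exact (hne rfl).elim
    · exact ⟨0, by simp [leaves], fun i => trivial⟩
  | node c ih =>
    rintro (_ | t) h hne
    · exact h.elim
    · have : ∃ i, c i ≠ t i := by
        by_contra hcon
        push Not at hcon
        exact hne (congrArg node (funext hcon))
      obtain ⟨i, hi⟩ := this
      obtain ⟨k, hk, hle⟩ := ih i (h i) hi
      refine ⟨offset (fun j => (c j).leaves) i + k, ?_, ?_⟩
      · have := offset_add_le_sum (fun j => (c j).leaves) i
        simp only [leaves]
        omega
      · rw [addCaret_node (i := i) c (by omega) (by omega)]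
        intro j
        by_cases hj : j = i
        · subst hj
          simpa using hle
        · rw [Function.update_of_ne hj]
          exact h j

theorem Le.eq_of_leaves_eq (hd : 2 ≤ d) {S T : DTree d} (h : S.Le T)
    (hl : S.leaves = T.leaves) : S = T := by
  by_contra hne
  obtain ⟨k, hk, hle⟩ := h.exists_addCaret hne
  have h1 := hle.leaves_le hd
  rw [leaves_addCaret hd _ hk] at h1
  omega

theorem addCaret_addCaret_le (hd : 2 ≤ d) (T : DTree d) : ∀ {V : DTree d} {k l : ℕ},
    k < l → l < T.leaves → (T.addCaret k).Le V → (T.addCaret l).Le V →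
    ((T.addCaret l).addCaret k).Le V := by
  induction T with
  | leaf => intro V k l h1 h2; simp [leaves] at h2; omega
  | node c ih =>
    rintro (_ | v) k l hkl hl hkV hlV
    · exact hkV.elim
    obtain ⟨j, hj1, hj2⟩ := exists_child _ hl
    obtain ⟨i, hi1, hi2⟩ := exists_child _ (hkl.trans hl)
    rw [addCaret_node c hj1 hj2] at hlV ⊢
    rw [addCaret_node c hi1 hi2] at hkV
    have hj3 : l - offset (fun j => (c j).leaves) j < (c j).leaves := by omega
    have hij : i ≤ j := by
      by_contra h
      have := offset_add_le (fun j => (c j).leaves) (not_le.mp h)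
      omega
    have o1 : offset (fun r => (Function.update c j
        ((c j).addCaret (l - offset (fun j => (c j).leaves) j)) r).leaves) i =
          offset (fun j => (c j).leaves) i := by
      rw [leaves_update, leaves_addCaret hd _ hj3, offset_update (fun j => (c j).leaves),
        if_neg hij.not_gt, add_zero]
    have hci : (c i).leaves ≤ (Function.update c j
        ((c j).addCaret (l - offset (fun j => (c j).leaves) j)) i).leaves := by
      by_cases h : i = j
      · subst h
        rw [Function.update_self, leaves_addCaret hd _ hj3]; omega
      · rw [Function.update_of_ne h]
    rw [addCaret_node (i := i) _ (by rw [o1]; exact hi1) (by rw [o1]; omega), o1]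
    intro p
    by_cases hp : p = i
    · subst hp
      rw [Function.update_self]
      have h1 := hkV p
      rw [Function.update_self] at h1
      by_cases h : p = j
      · subst h
        have h2 := hlV p
        rw [Function.update_self] at h2 ⊢
        exact ih p (by omega) hj3 h1 h2
      · rw [Function.update_of_ne h]
        exact h1
    · rw [Function.update_of_ne hp]
      exact hlV p

end DTree

end ThompsonLike

namespace ThompsonLike

/-! ### Cloning systems -/

/-- The map underlying the standard cloning map: in the arrow diagram of `σ`, the arrow number `k`
is replaced by `m + 1` parallel arrows. -/
def stdCloneFun (m : ℕ) {n : ℕ} (σ : Equiv.Perm (Fin n)) (k : Fin n) (i : Fin (n + m)) :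
    Fin (n + m) :=
  if h1 : (i : ℕ) < k then
    if (σ ⟨i, h1.trans k.2⟩ : ℕ) < σ k then (σ ⟨i, h1.trans k.2⟩).castAdd m
    else (σ ⟨i, h1.trans k.2⟩).addNat m
  else if h2 : (i : ℕ) ≤ k + m then ⟨σ k + (i - k), by omega⟩
  else if (σ ⟨i - m, by omega⟩ : ℕ) < σ k then (σ ⟨i - m, by omega⟩).castAdd m
    else (σ ⟨i - m, by omega⟩).addNat m

theorem stdCloneFun_symm (m : ℕ) {n : ℕ} (σ : Equiv.Perm (Fin n)) (k : Fin n)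
    (i : Fin (n + m)) : stdCloneFun m σ⁻¹ (σ k) (stdCloneFun m σ k i) = i := by
  have key : ∀ j : Fin n, j ≠ k → (σ j : ℕ) ≠ σ k := fun j hj h =>
    hj (σ.injective (Fin.ext h))
  have hk := (σ k).2
  by_cases h1 : (i : ℕ) < k
  · have hne := key ⟨i, h1.trans k.2⟩ (fun h => by rw [← h] at h1; simp at h1)
    by_cases h3 : (σ ⟨i, h1.trans k.2⟩ : ℕ) < σ k
    · have e : stdCloneFun m σ k i = (σ ⟨i, h1.trans k.2⟩).castAdd m := by
        simp [stdCloneFun, h1, h3]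
      rw [e]
      simp [stdCloneFun, h3, h1]
    · have e : stdCloneFun m σ k i = (σ ⟨i, h1.trans k.2⟩).addNat m := by
        simp [stdCloneFun, h1, h3]
      rw [e]
      have a1 : ¬ ((σ ⟨i, h1.trans k.2⟩ : ℕ) + m < σ k) := by
        omega
      have a2 : ¬ ((σ ⟨i, h1.trans k.2⟩ : ℕ) + m ≤ σ k + m) := by
        omega
      have a3 : ¬ ((σ ⟨i, h1.trans k.2⟩ : ℕ) ≤ σ k) := by omega
      simp [stdCloneFun, a1, a3, h1]
  · by_cases h2 : (i : ℕ) ≤ k + m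
    · have e : stdCloneFun m σ k i = ⟨σ k + (i - k), by omega⟩ := by
        simp [stdCloneFun, h1, h2]
      rw [e]
      have a2 : (i : ℕ) - k ≤ m := by omega
      have a3 : (k : ℕ) + (i - k) = i := by omega
      simp [stdCloneFun, a2, a3]
    · have hne := key ⟨i - m, by omega⟩ (fun h => by
        have := congrArg Fin.val h; simp at this; omega)
      have h4 : ¬ ((i : ℕ) - m < k) := by omega
      have h5 : (i : ℕ) - m + m = i := by omega
      by_cases h3 : (σ ⟨i - m, by omega⟩ : ℕ) < σ k
      · have e : stdCloneFun m σ k i = (σ ⟨i - m, by omega⟩).castAdd m := by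
          simp [stdCloneFun, h1, h2, h3]
        rw [e]
        have h3' : (σ ⟨i - m, by omega⟩ : ℕ) < σ k := h3
        simp [stdCloneFun, h3', h4]
        exact Fin.ext h5
      · have e : stdCloneFun m σ k i = (σ ⟨i - m, by omega⟩).addNat m := by
          simp [stdCloneFun, h1, h2, h3]
        rw [e]
        have h3' : ¬ (σ ⟨i - m, by omega⟩ : ℕ) < σ k := h3
        have a1 : ¬ ((σ ⟨i - m, by omega⟩ : ℕ) + m < σ k) := by omega
        have a3 : ¬ ((σ ⟨i - m, by omega⟩ : ℕ) ≤ σ k) := by omega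
        simp [stdCloneFun, a1, a3, h4]
        exact Fin.ext h5

/-- The standard `d`-ary cloning map `ς_k^n : S_n → S_{n + d - 1}` for `m = d - 1`: in the arrow
diagram of `σ`, the arrow number `k` is replaced by `d = m + 1` parallel arrows. -/
def stdClone (m : ℕ) {n : ℕ} (σ : Equiv.Perm (Fin n)) (k : Fin n) :
    Equiv.Perm (Fin (n + m)) where
  toFun := stdCloneFun m σ k
  invFun := stdCloneFun m σ⁻¹ (σ k)
  left_inv := stdCloneFun_symm m σ k
  right_inv i := by
    have h := stdCloneFun_symm m σ⁻¹ (σ k) i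
    have e : σ⁻¹ (σ k) = k := σ.symm_apply_apply k
    rwa [inv_inv, e] at h

/-- A `d`-ary cloning system on a sequence of groups `G 0, G 1, G 2, …` (only the `G n` with
`n ≥ 1` matter). The indices `1, …, n` are written as `0, …, n - 1`, and the right action
`(g)κ_k^n` is written `kappa n k g`. -/
structure CloningSystem (d : ℕ) (G : ℕ → Type u) [∀ n, Group (G n)] where
  two_le : 2 ≤ d
  /-- the representation maps `ρ_n` -/
  rho : ∀ n, G n →* Equiv.Perm (Fin n)
  /-- the cloning maps `κ_k^n` -/
  kappa : ∀ n, Fin n → G n → G (n + (d - 1))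
  kappa_injective : ∀ n k, Function.Injective (kappa n k)
  /-- cloning a product -/
  kappa_mul : ∀ (n : ℕ) (k : Fin n) (g h : G n),
    kappa n k (g * h) = kappa n (rho n h k) g * kappa n k h
  /-- product of clonings -/
  kappa_comm : ∀ (n : ℕ) (k l : Fin n), k < l → ∀ g : G n,
    kappa (n + (d - 1)) (k.castAdd (d - 1)) (kappa n l g) =
      kappa (n + (d - 1)) (l.addNat (d - 1)) (kappa n k g)
  /-- compatibility -/
  rho_kappa : ∀ (n : ℕ) (k : Fin n) (g : G n) (i : Fin (n + (d - 1))),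
    ¬ ((k : ℕ) ≤ i ∧ (i : ℕ) ≤ k + (d - 1)) →
    rho (n + (d - 1)) (kappa n k g) i = stdClone (d - 1) (rho n g) k i

/-- A cloning system is diverse if for all large `n` the images of the cloning maps
`κ_1^n, …, κ_n^n` intersect trivially. -/
def CloningSystem.IsDiverse {d : ℕ} {G : ℕ → Type u} [∀ n, Group (G n)]
    (S : CloningSystem d G) : Prop :=
  ∃ n₀ : ℕ, ∀ n, n₀ ≤ n → ⋂ k : Fin n, Set.range (S.kappa n k) = {1}

/-! ### The Thompson-like group -/

/-- Triples `(T, g, U)` of two trees with the same number `n` of leaves and an element of `G n`. -/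
structure Triple (d : ℕ) (G : ℕ → Type u) where
  n : ℕ
  T : DTree d
  U : DTree d
  hT : T.leaves = n
  hU : U.leaves = n
  g : G n

theorem Triple.mk_congr {d : ℕ} {G : ℕ → Type u} {n : ℕ} {T T' U U' : DTree d}
    {hT : T.leaves = n} {hU : U.leaves = n} {hT' : T'.leaves = n} {hU' : U'.leaves = n}
    {g g' : G n} (h1 : T = T') (h2 : g = g') (h3 : U = U') :
    Triple.mk n T U hT hU g = Triple.mk n T' U' hT' hU' g' := by
  subst h1 h2 h3; rfl

namespace CloningSystem

variable {d : ℕ} {G : ℕ → Type u} [∀ n, Group (G n)] (S : CloningSystem d G)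

theorem kappa_one (n : ℕ) (k : Fin n) : S.kappa n k 1 = 1 := by
  have h := S.kappa_mul n k 1 1
  simpa using h

theorem kappa_inv (n : ℕ) (k : Fin n) (g : G n) :
    (S.kappa n k g)⁻¹ = S.kappa n (S.rho n g k) g⁻¹ := by
  have h := S.kappa_mul n k g⁻¹ g
  rw [inv_mul_cancel, kappa_one] at h
  exact inv_eq_of_mul_eq_one_left h.symm

/-- The expansion of `(T, g, U)` at `k` adds a caret to the `k`-th leaf of `U` and to the
`ρ_n(g)(k)`-th leaf of `T`, and replaces `g` by `(g)κ_k^n`. -/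
def expand (x : Triple d G) (k : Fin x.n) : Triple d G where
  n := x.n + (d - 1)
  T := x.T.addCaret (S.rho x.n x.g k)
  U := x.U.addCaret k
  hT := by rw [DTree.leaves_addCaret S.two_le _ (by rw [x.hT]; exact Fin.is_lt _), x.hT]
  hU := by rw [DTree.leaves_addCaret S.two_le _ (by rw [x.hU]; exact Fin.is_lt _), x.hU]
  g := S.kappa x.n k x.g

/-- `S.Step x y`: the triple `y` is an expansion of the triple `x`. -/
def Step (x y : Triple d G) : Prop := ∃ k : Fin x.n, y = S.expand x k

/-- The equivalence relation on triples generated by expansions. -/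
def tripleSetoid : Setoid (Triple d G) := Relation.EqvGen.setoid S.Step

/-- The set `𝒯_d(G_*)` of equivalence classes `[T, g, U]`. -/
def Grp : Type u := Quotient S.tripleSetoid

/-- The class `[T, g, U]` of a triple. -/
def cls (x : Triple d G) : S.Grp := Quotient.mk S.tripleSetoid x

/-- Several expansions in a row. -/
abbrev Steps : Triple d G → Triple d G → Prop := Relation.ReflTransGen S.Step

theorem cls_eq_of_steps {x y : Triple d G} (h : S.Steps x y) : S.cls x = S.cls y := by
  apply Quotient.sound
  induction h with
  | refl => exact Relation.EqvGen.refl _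
  | tail _ h2 ih => exact ih.trans _ _ _ (Relation.EqvGen.rel _ _ h2)

theorem expand_comm (x : Triple d G) {k l : Fin x.n} (h : k < l) :
    S.expand (S.expand x l) (k.castAdd (d - 1)) =
      S.expand (S.expand x k) (l.addNat (d - 1)) := by
  have hd := S.two_le
  obtain ⟨n, T, U, hT, hU, g⟩ := x
  simp only at k l h
  have hkl : (k : ℕ) < l := h
  have r1 := S.rho_kappa n l g (k.castAdd (d - 1)) (by simp; omega)
  have r2 := S.rho_kappa n k g (l.addNat (d - 1)) (by simp; omega)
  have e1 : (S.rho (n + (d - 1)) (S.kappa n l g) (k.castAdd (d - 1)) : ℕ) =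
      if (S.rho n g k : ℕ) < S.rho n g l then (S.rho n g k : ℕ)
      else S.rho n g k + (d - 1) := by
    rw [r1]
    simp only [stdClone, Equiv.coe_fn_mk, stdCloneFun, Fin.val_castAdd, hkl, dif_pos]
    split_ifs <;> rfl
  have e2 : (S.rho (n + (d - 1)) (S.kappa n k g) (l.addNat (d - 1)) : ℕ) =
      if (S.rho n g l : ℕ) < S.rho n g k then (S.rho n g l : ℕ)
      else S.rho n g l + (d - 1) := by
    rw [r2]
    have a1 : ¬ ((l : ℕ) + (d - 1) < k) := by omega
    have a2 : ¬ ((l : ℕ) ≤ k) := by omega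
    simp only [stdClone, Equiv.coe_fn_mk, stdCloneFun, Fin.val_addNat, a1, dif_neg,
      not_false_eq_true, add_le_add_iff_right, a2, Nat.add_sub_cancel, Fin.eta]
    split_ifs <;> rfl
  have hne : (S.rho n g k : ℕ) ≠ S.rho n g l := fun hh =>
    h.ne ((S.rho n g).injective (Fin.ext hh))
  apply Triple.mk_congr
  · change (T.addCaret (S.rho n g l)).addCaret
        (S.rho (n + (d - 1)) (S.kappa n l g) (k.castAdd (d - 1))) =
      (T.addCaret (S.rho n g k)).addCaret
        (S.rho (n + (d - 1)) (S.kappa n k g) (l.addNat (d - 1)))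
    rw [e1, e2]
    rcases lt_or_gt_of_ne hne with hlt | hlt
    · rw [if_pos hlt, if_neg hlt.not_gt]
      exact DTree.addCaret_comm hd T hlt (by rw [hT]; exact Fin.is_lt _)
    · rw [if_neg hlt.not_gt, if_pos hlt]
      exact (DTree.addCaret_comm hd T hlt (by rw [hT]; exact Fin.is_lt _)).symm
  · exact S.kappa_comm n k l h g
  · exact DTree.addCaret_comm hd U hkl (by rw [hU]; exact Fin.is_lt _)

theorem Steps.le {x y : Triple d G} (h : S.Steps x y) : x.U.Le y.U := by
  induction h with
  | refl => exact DTree.Le.refl _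
  | tail _ h2 ih =>
    obtain ⟨k, rfl⟩ := h2
    exact ih.trans (DTree.le_addCaret _ _)

theorem Steps.n_le {x y : Triple d G} (h : S.Steps x y) : x.n ≤ y.n := by
  rw [← x.hU, ← y.hU]
  exact (Steps.le S h).leaves_le S.two_le

theorem Steps.eq_of_n {x y : Triple d G} (h : S.Steps x y) (hn : x.n = y.n) : x = y := by
  rcases Relation.ReflTransGen.cases_head h with h | ⟨z, ⟨k, rfl⟩, hz⟩
  · exact h
  · have h1 : x.n + (d - 1) ≤ y.n := Steps.n_le S hz
    have := S.two_le
    omega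

theorem exists_steps (m : ℕ) : ∀ (x : Triple d G) (V : DTree d), V.leaves ≤ x.n + m → x.U.Le V →
    ∃ y, S.Steps x y ∧ y.U = V := by
  have hd := S.two_le
  induction m with
  | zero =>
    intro x V hV hle
    refine ⟨x, .refl, hle.eq_of_leaves_eq hd ?_⟩
    have := hle.leaves_le hd
    have := x.hU
    omega
  | succ m ih =>
    intro x V hV hle
    by_cases h : x.U = V
    · exact ⟨x, .refl, h⟩
    obtain ⟨k, hk, hkV⟩ := hle.exists_addCaret h
    rw [x.hU] at hk
    obtain ⟨y, hy, hyV⟩ := ih (S.expand x ⟨k, hk⟩) V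
      (by change V.leaves ≤ x.n + (d - 1) + m; omega) hkV
    exact ⟨y, .head ⟨_, rfl⟩ hy, hyV⟩

theorem exists_steps_of_le (x : Triple d G) {V : DTree d} (h : x.U.Le V) :
    ∃ y, S.Steps x y ∧ y.U = V :=
  S.exists_steps V.leaves x V (by omega) h

theorem steps_unique (m : ℕ) : ∀ (x y z : Triple d G), y.n ≤ x.n + m → S.Steps x y →
    S.Steps x z → y.U = z.U → y = z := by
  have hd := S.two_le
  induction m with
  | zero =>
    intro x y z hm hy hz hU
    have h1 := Steps.n_le S hy
    have h2 := Steps.eq_of_n S hy (by omega)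
    subst h2
    refine Steps.eq_of_n S hz ?_
    rw [← x.hU, ← z.hU, hU]
  | succ m ih =>
    intro x y z hm hy hz hU
    have hyz : y.n = z.n := by rw [← y.hU, ← z.hU, hU]
    rcases Relation.ReflTransGen.cases_head hy with h | ⟨y', ⟨k, rfl⟩, hy'⟩
    · subst h
      exact Steps.eq_of_n S hz hyz
    rcases Relation.ReflTransGen.cases_head hz with h | ⟨z', ⟨l, rfl⟩, hz'⟩
    · subst h
      exact (Steps.eq_of_n S hy hyz.symm).symm
    have key : ∀ (k l : Fin x.n) (y z : Triple d G), y.n ≤ x.n + (m + 1) → z.n ≤ x.n + (m + 1) →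
        S.Steps (S.expand x k) y → S.Steps (S.expand x l) z → y.U = z.U → k < l → y = z := by
      intro k l y z hym hzm hy hz hU hkl
      have hle : (S.expand (S.expand x l) (k.castAdd (d - 1))).U.Le y.U := by
        refine DTree.addCaret_addCaret_le hd x.U hkl (by rw [x.hU]; exact l.2) (Steps.le S hy) ?_
        rw [hU]
        exact Steps.le S hz
      obtain ⟨w, hw, hwU⟩ := S.exists_steps_of_le _ hle
      have h1 : w = y := by
        have hwn : w.n = y.n := by rw [← w.hU, ← y.hU, hwU]
        rw [S.expand_comm x hkl] at hw
        refine ih (S.expand x k) w y ?_ (.head ⟨_, rfl⟩ hw) hy hwU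
        change w.n ≤ x.n + (d - 1) + m
        omega
      have h2 : w = z := by
        have hwn : w.n = z.n := by rw [← w.hU, ← z.hU, hwU, hU]
        refine ih (S.expand x l) w z ?_ (.head ⟨_, rfl⟩ hw) hz (hwU.trans hU)
        change w.n ≤ x.n + (d - 1) + m
        omega
      rw [← h1, h2]
    rcases lt_trichotomy k l with h | h | h
    · exact key k l y z hm (by omega) hy' hz' hU h
    · subst h
      refine ih (S.expand x k) y z ?_ hy' hz' hU
      change y.n ≤ x.n + (d - 1) + m
      omega
    · exact (key l k z y (by omega) hm hz' hy' hU.symm h).symm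

theorem Steps.unique {x y z : Triple d G} (hy : S.Steps x y) (hz : S.Steps x z)
    (hU : y.U = z.U) : y = z :=
  S.steps_unique y.n x y z (by omega) hy hz hU

theorem Steps.confluent {x y z : Triple d G} (hy : S.Steps x y) (hz : S.Steps x z) :
    ∃ w, S.Steps y w ∧ S.Steps z w := by
  obtain ⟨v, hv, hvU⟩ := S.exists_steps_of_le y (DTree.le_sup_left y.U z.U)
  obtain ⟨w, hw, hwU⟩ := S.exists_steps_of_le z (DTree.le_sup_right y.U z.U)
  have : v = w := Steps.unique S (hy.trans hv) (hz.trans hw) (hvU.trans hwU.symm)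
  subst this
  exact ⟨v, hv, hw⟩

theorem exists_of_cls_eq {x y : Triple d G} (h : S.cls x = S.cls y) :
    ∃ w, S.Steps x w ∧ S.Steps y w := by
  have h' : Relation.EqvGen S.Step x y := Quotient.exact h
  clear h
  induction h' with
  | rel x y h => exact ⟨y, .single h, .refl⟩
  | refl x => exact ⟨x, .refl, .refl⟩
  | symm x y h ih =>
    obtain ⟨w, h1, h2⟩ := ih
    exact ⟨w, h2, h1⟩
  | trans x y z h1 h2 ih1 ih2 =>
    obtain ⟨v, hv1, hv2⟩ := ih1
    obtain ⟨w, hw1, hw2⟩ := ih2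
    obtain ⟨t, ht1, ht2⟩ := Steps.confluent S hv2 hw1
    exact ⟨t, hv1.trans ht1, hw2.trans ht2⟩

/-- The inverse triple `(U, g⁻¹, T)`. -/
def _root_.ThompsonLike.Triple.inv (x : Triple d G) : Triple d G :=
  ⟨x.n, x.U, x.T, x.hU, x.hT, x.g⁻¹⟩

theorem expand_inv (x : Triple d G) (k : Fin x.n) :
    (S.expand x k).inv = S.expand x.inv (S.rho x.n x.g k) := by
  apply Triple.mk_congr
  · change x.U.addCaret k = x.U.addCaret (S.rho x.n x.g⁻¹ (S.rho x.n x.g k))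
    rw [map_inv, show (S.rho x.n x.g)⁻¹ (S.rho x.n x.g k) = k from
      (S.rho x.n x.g).symm_apply_apply k]
  · exact S.kappa_inv x.n k x.g
  · rfl

theorem Steps.inv {x y : Triple d G} (h : S.Steps x y) : S.Steps x.inv y.inv := by
  induction h with
  | refl => exact .refl
  | tail _ h2 ih =>
    obtain ⟨k, rfl⟩ := h2
    exact ih.tail ⟨_, S.expand_inv _ k⟩

theorem exists_steps_of_le' (x : Triple d G) {V : DTree d} (h : x.T.Le V) :
    ∃ y, S.Steps x y ∧ y.T = V := by
  obtain ⟨y, hy, hyV⟩ := S.exists_steps_of_le x.inv h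
  have h1 := Steps.inv S hy
  have h2 : x.inv.inv = x := Triple.mk_congr rfl (inv_inv x.g) rfl
  rw [h2] at h1
  exact ⟨y.inv, h1, hyV⟩

/-- `IsMul x y z` says that `x = (T, g, U)`, `y = (U, h, W)` and `z = (T, gh, W)`. -/
inductive IsMul : Triple d G → Triple d G → Triple d G → Prop
  | mk (n : ℕ) (T U W : DTree d) (hT : T.leaves = n) (hU : U.leaves = n) (hW : W.leaves = n)
      (g h : G n) : IsMul ⟨n, T, U, hT, hU, g⟩ ⟨n, U, W, hU, hW, h⟩ ⟨n, T, W, hT, hW, g * h⟩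

theorem IsMul.exists {x y : Triple d G} (h : x.U = y.T) : ∃ z, IsMul x y z := by
  obtain ⟨n, T, U, hT, hU, g⟩ := x
  obtain ⟨m, U', W, hU', hW, g'⟩ := y
  simp only at h
  subst h
  obtain rfl : n = m := hU.symm.trans hU'
  exact ⟨_, IsMul.mk n T U W hT hU hW g g'⟩

theorem IsMul.U_eq {x y z : Triple d G} (h : IsMul x y z) : x.U = y.T := by
  cases h; rfl

theorem IsMul.unique {x y z z' : Triple d G} (h : IsMul x y z) (h' : IsMul x y z') : z = z' := by
  cases h; cases h'; rfl

theorem IsMul.step {x y z : Triple d G} (h : IsMul x y z) (k : Fin y.n) :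
    ∃ x' z', S.Step x x' ∧ S.Step z z' ∧ IsMul x' (S.expand y k) z' := by
  cases h with
  | mk n T U W hT hU hW g h =>
    simp only at k
    refine ⟨S.expand ⟨n, T, U, hT, hU, g⟩ (S.rho n h k), S.expand ⟨n, T, W, hT, hW, g * h⟩ k,
      ⟨_, rfl⟩, ⟨_, rfl⟩, ?_⟩
    have e : S.expand ⟨n, T, W, hT, hW, g * h⟩ k =
        ⟨n + (d - 1), T.addCaret (S.rho n g (S.rho n h k)), W.addCaret k,
          (S.expand ⟨n, T, U, hT, hU, g⟩ (S.rho n h k)).hT,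
          (S.expand ⟨n, U, W, hU, hW, h⟩ k).hU,
          S.kappa n (S.rho n h k) g * S.kappa n k h⟩ := by
      apply Triple.mk_congr
      · change T.addCaret (S.rho n (g * h) k) = _
        rw [map_mul]; rfl
      · exact S.kappa_mul n k g h
      · rfl
    rw [e]
    exact IsMul.mk _ _ _ _ _ _ _ _ _

theorem IsMul.steps_right {x y z y' : Triple d G} (h : IsMul x y z) (hy : S.Steps y y') :
    ∃ x' z', S.Steps x x' ∧ S.Steps z z' ∧ IsMul x' y' z' := by
  induction hy with
  | refl => exact ⟨x, z, .refl, .refl, h⟩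
  | tail _ h2 ih =>
    obtain ⟨x', z', hx', hz', hm⟩ := ih
    obtain ⟨k, rfl⟩ := h2
    obtain ⟨x'', z'', hx'', hz'', hm'⟩ := IsMul.step S hm k
    exact ⟨x'', z'', hx'.tail hx'', hz'.tail hz'', hm'⟩

theorem IsMul.steps_left {x y z x' : Triple d G} (h : IsMul x y z) (hx : S.Steps x x') :
    ∃ y' z', S.Steps y y' ∧ S.Steps z z' ∧ IsMul x' y' z' := by
  have hle : y.T.Le x'.U := by rw [← h.U_eq]; exact Steps.le S hx
  obtain ⟨y', hy', hyT⟩ := S.exists_steps_of_le' y hle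
  obtain ⟨x'', z', hx'', hz', hm⟩ := IsMul.steps_right S h hy'
  have : x'' = x' := Steps.unique S hx'' hx (hm.U_eq.trans hyT)
  subst this
  exact ⟨y', z', hy', hz', hm⟩

theorem IsMul.cls_eq {x y z x' y' z' : Triple d G} (h : IsMul x y z) (h' : IsMul x' y' z')
    (hx : S.cls x = S.cls x') (hy : S.cls y = S.cls y') : S.cls z = S.cls z' := by
  obtain ⟨w, hw, hw'⟩ := S.exists_of_cls_eq hx
  obtain ⟨y₁, z₁, hy₁, hz₁, hm₁⟩ := IsMul.steps_left S h hw
  obtain ⟨y₂, z₂, hy₂, hz₂, hm₂⟩ := IsMul.steps_left S h' hw'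
  have hyy : S.cls y₁ = S.cls y₂ := by
    rw [← S.cls_eq_of_steps hy₁, ← S.cls_eq_of_steps hy₂, hy]
  obtain ⟨v, hv₁, hv₂⟩ := S.exists_of_cls_eq hyy
  obtain ⟨w₁, z₃, hw₁, hz₃, hm₃⟩ := IsMul.steps_right S hm₁ hv₁
  obtain ⟨w₂, z₄, hw₂, hz₄, hm₄⟩ := IsMul.steps_right S hm₂ hv₂
  have : w₁ = w₂ := Steps.unique S hw₁ hw₂ (hm₃.U_eq.trans hm₄.U_eq.symm)
  subst this
  have : z₃ = z₄ := hm₃.unique hm₄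
  subst this
  rw [S.cls_eq_of_steps hz₁, S.cls_eq_of_steps hz₃, S.cls_eq_of_steps hz₂,
    S.cls_eq_of_steps hz₄]

theorem exists_isMul (x y : Triple d G) :
    ∃ x' y' z, S.Steps x x' ∧ S.Steps y y' ∧ IsMul x' y' z := by
  obtain ⟨x', hx', hxU⟩ := S.exists_steps_of_le x (DTree.le_sup_left x.U y.T)
  obtain ⟨y', hy', hyT⟩ := S.exists_steps_of_le' y (DTree.le_sup_right x.U y.T)
  obtain ⟨z, hz⟩ := IsMul.exists (hxU.trans hyT.symm)
  exact ⟨x', y', z, hx', hy', hz⟩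

theorem exists_mul (a b : S.Grp) :
    ∃ c, ∃ x y z, a = S.cls x ∧ b = S.cls y ∧ c = S.cls z ∧ IsMul x y z := by
  obtain ⟨x, rfl⟩ : ∃ x, S.cls x = a := Quotient.exists_rep a
  obtain ⟨y, rfl⟩ : ∃ y, S.cls y = b := Quotient.exists_rep b
  obtain ⟨x', y', z, hx, hy, hz⟩ := S.exists_isMul x y
  exact ⟨_, x', y', z, S.cls_eq_of_steps hx, S.cls_eq_of_steps hy, rfl, hz⟩

/-- Multiplication in `𝒯_d(G_*)`: the product of `a = [T, g, U]` and `b = [U, h, W]` is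
`[T, gh, W]` (see `cls_mul`). -/
noncomputable instance : Mul S.Grp := ⟨fun a b => (S.exists_mul a b).choose⟩

theorem cls_mul {x y z : Triple d G} (h : IsMul x y z) : S.cls x * S.cls y = S.cls z := by
  obtain ⟨x', y', z', hx, hy, hz, hm⟩ := (S.exists_mul (S.cls x) (S.cls y)).choose_spec
  exact hz.trans (IsMul.cls_eq S hm h hx.symm hy.symm)

/-- The identity is `[T, 1, T]` for the tree `T` with one vertex (and so for every `T`, see
`cls_one`). -/
instance : One S.Grp := ⟨S.cls ⟨1, .leaf, .leaf, rfl, rfl, 1⟩⟩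

/-- The inverse of `[T, g, U]` is `[U, g⁻¹, T]`. -/
instance : Inv S.Grp := ⟨Quotient.map' Triple.inv (by
  intro x y h
  obtain ⟨w, h1, h2⟩ := S.exists_of_cls_eq (Quotient.sound h)
  exact Quotient.exact ((S.cls_eq_of_steps (Steps.inv S h1)).trans
    (S.cls_eq_of_steps (Steps.inv S h2)).symm))⟩

theorem cls_inv (x : Triple d G) : (S.cls x)⁻¹ = S.cls x.inv := rfl

theorem Steps.one_of_one {x y : Triple d G} (h : S.Steps x y) (hx : x.g = 1) : y.g = 1 := by
  induction h with
  | refl => exact hx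
  | tail _ h2 ih =>
    obtain ⟨k, rfl⟩ := h2
    change S.kappa _ k _ = 1
    rw [ih, S.kappa_one]

theorem Steps.T_eq_U {x y : Triple d G} (h : S.Steps x y) (hx : x.g = 1) (hxT : x.T = x.U) :
    y.T = y.U := by
  induction h with
  | refl => exact hxT
  | tail h1 h2 ih =>
    obtain ⟨k, rfl⟩ := h2
    change DTree.addCaret _ _ = DTree.addCaret _ _
    rw [ih, Steps.one_of_one S h1 hx, map_one]
    rfl

theorem cls_one (n : ℕ) (T : DTree d) (hT hT' : T.leaves = n) :
    S.cls ⟨n, T, T, hT, hT', 1⟩ = 1 := by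
  obtain ⟨y, hy, hyT⟩ := S.exists_steps_of_le (⟨1, .leaf, .leaf, rfl, rfl, 1⟩ : Triple d G)
    (V := T) trivial
  have h1 := Steps.one_of_one S hy rfl
  have h2 := Steps.T_eq_U S hy rfl rfl
  refine Eq.trans ?_ (S.cls_eq_of_steps hy).symm
  obtain ⟨m, T', U', hT', hU', g⟩ := y
  obtain rfl : g = (1 : G m) := h1
  obtain rfl : T' = U' := h2
  obtain rfl : T' = T := hyT
  obtain rfl : n = m := hT.symm.trans hU'
  rfl

/-- The Thompson-like group `𝒯_d(G_*)` of a `d`-ary cloning system. -/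
noncomputable instance : Group S.Grp :=
  Group.ofLeftAxioms
    (by
      intro a b c
      obtain ⟨ab, x, y, p, rfl, rfl, rfl, hxy⟩ := S.exists_mul a b
      obtain ⟨z, rfl⟩ : ∃ z, S.cls z = c := Quotient.exists_rep c
      obtain ⟨y', z', q, hy', hz', hq⟩ := S.exists_isMul y z
      obtain ⟨x', p', hx', hp', hm⟩ := IsMul.steps_right S hxy hy'
      rw [S.cls_eq_of_steps hx', S.cls_eq_of_steps hy', S.cls_eq_of_steps hz', S.cls_mul hq,
        S.cls_mul hm]
      cases hm with
      | mk n T U W hT hU hW g h =>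
        cases hq with
        | mk _ _ _ X _ _ hX _ k =>
          rw [S.cls_mul (IsMul.mk n T W X hT hW hX (g * h) k),
            S.cls_mul (IsMul.mk n T U X hT hU hX g (h * k)), mul_assoc])
    (by
      intro a
      obtain ⟨x, rfl⟩ : ∃ x, S.cls x = a := Quotient.exists_rep a
      obtain ⟨n, T, U, hT, hU, g⟩ := x
      have h := S.cls_mul (IsMul.mk n T T U hT hT hU 1 g)
      rwa [S.cls_one, one_mul] at h)
    (by
      intro a
      obtain ⟨x, rfl⟩ : ∃ x, S.cls x = a := Quotient.exists_rep a
      obtain ⟨n, T, U, hT, hU, g⟩ := x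
      have h := S.cls_mul (IsMul.mk n U T U hU hT hU g⁻¹ g)
      rwa [inv_mul_cancel, S.cls_one] at h)

/-- The canonical copy of the Higman–Thompson group `F_d` in `𝒯_d(G_*)`: all elements of the form
`[T, 1, U]`. -/
noncomputable def higmanThompsonF : Subgroup S.Grp where
  carrier := {a | ∃ x : Triple d G, x.g = 1 ∧ S.cls x = a}
  one_mem' := ⟨_, rfl, rfl⟩
  inv_mem' := by
    rintro _ ⟨x, hx, rfl⟩
    exact ⟨x.inv, inv_eq_one.mpr hx, rfl⟩
  mul_mem' := by
    rintro _ _ ⟨x, hx, rfl⟩ ⟨y, hy, rfl⟩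
    obtain ⟨x', y', z, hx', hy', hm⟩ := S.exists_isMul x y
    refine ⟨z, ?_, ?_⟩
    · have h1 := Steps.one_of_one S hx' hx
      have h2 := Steps.one_of_one S hy' hy
      cases hm with
      | mk n T U W hT hU hW g h =>
        simp only at h1 h2
        simp [h1, h2]
    · rw [S.cls_eq_of_steps hx', S.cls_eq_of_steps hy', S.cls_mul hm]

end CloningSystem

end ThompsonLike

/-! ### Inclusions of von Neumann algebras -/

namespace VNInclusion

variable {H : Type u} [NormedAddCommGroup H] [InnerProductSpace ℂ H] [CompleteSpace H]

/-- The von Neumann algebra generated by a set of operators, i.e. the double commutant of the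
star-closure of the set. -/
noncomputable def generated (s : Set (H →L[ℂ] H)) : VonNeumannAlgebra H where
  toStarSubalgebra :=
    StarSubalgebra.centralizer ℂ (StarSubalgebra.centralizer ℂ s : Set (H →L[ℂ] H))
  centralizer_centralizer' := by
    change Set.centralizer (Set.centralizer (StarSubalgebra.centralizer ℂ
      (StarSubalgebra.centralizer ℂ s : Set (H →L[ℂ] H)) : Set (H →L[ℂ] H))) = _
    rw [StarSubalgebra.coe_centralizer_centralizer, Set.centralizer_centralizer_centralizer]
    exact (StarSubalgebra.coe_centralizer_centralizer ℂ s).symm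

/-- The elements of a von Neumann algebra, as a type. -/
abbrev Elem (M : VonNeumannAlgebra H) : Type u := M.toStarSubalgebra

/-- The norm `‖x‖₂ = τ(x* x)^{1/2}`. -/
noncomputable def twoNorm {M : VonNeumannAlgebra H} (τ : Elem M →ₗ[ℂ] ℂ) (x : Elem M) : ℝ :=
  Real.sqrt (τ (star x * x)).re

/-- `E` is a `τ`-preserving conditional expectation of `M` onto its von Neumann subalgebra `N`:
a positive `N`-bimodular projection of `M` onto `N` with `τ ∘ E = τ`. For a normal, finite,
faithful, normalized trace `τ` there is exactly one such `E`, and it is automatically faithful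
and normal. -/
structure IsCondExp (N M : VonNeumannAlgebra H) (τ : Elem M →ₗ[ℂ] ℂ)
    (E : Elem M →ₗ[ℂ] Elem M) : Prop where
  le : N ≤ M
  mem : ∀ x, (E x : H →L[ℂ] H) ∈ N
  eq_self : ∀ x : Elem M, (x : H →L[ℂ] H) ∈ N → E x = x
  bimodule : ∀ a x b : Elem M, (a : H →L[ℂ] H) ∈ N → (b : H →L[ℂ] H) ∈ N →
    E (a * x * b) = a * E x * b
  positive : ∀ x : Elem M, (x : H →L[ℂ] H).IsPositive → (E x : H →L[ℂ] H).IsPositive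
  trace : ∀ x, τ (E x) = τ x

/-- The weak asymptotic homomorphism property of the inclusion `N ⊆ M` of von Neumann algebras,
where `M` carries the trace `τ`: there is a net `(u_i)` of unitaries in `N` such that
`‖E_N(x u_i y) - E_N(x) u_i E_N(y)‖₂ → 0` for all `x, y ∈ M`. -/
def WeakAsymptoticHomomorphismProperty (N M : VonNeumannAlgebra H) (τ : Elem M →ₗ[ℂ] ℂ) : Prop :=
  ∃ E : Elem M →ₗ[ℂ] Elem M, IsCondExp N M τ E ∧
    ∃ (ι : Type u) (_ : Preorder ι) (_ : IsDirected ι (· ≤ ·)) (_ : Nonempty ι) (u : ι → Elem M),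
      (∀ i, (u i : H →L[ℂ] H) ∈ N ∧ u i ∈ unitary (Elem M)) ∧
      ∀ x y : Elem M,
        Filter.Tendsto (fun i => twoNorm τ (E (x * u i * y) - E x * u i * E y))
          Filter.atTop (nhds 0)

/-- The inclusion `N ⊆ M` is weakly mixing: for every finite set `s` of elements of `M` that are
orthogonal to `N` (i.e. `E_N(x) = 0` for `x ∈ s`) and every `ε > 0` there is a unitary `v ∈ N`
with `‖E_N(x v y)‖₂ < ε` for all `x, y ∈ s`. -/
def WeaklyMixing (N M : VonNeumannAlgebra H) (τ : Elem M →ₗ[ℂ] ℂ) : Prop :=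
  ∃ E : Elem M →ₗ[ℂ] Elem M, IsCondExp N M τ E ∧
    ∀ s : Finset (Elem M), (∀ x ∈ s, E x = 0) → ∀ ε : ℝ, 0 < ε →
      ∃ v : Elem M, (v : H →L[ℂ] H) ∈ N ∧ v ∈ unitary (Elem M) ∧
        ∀ x ∈ s, ∀ y ∈ s, twoNorm τ (E (x * v * y)) < ε

end VNInclusion

/-! ### Group von Neumann algebras -/

namespace GroupVN

variable {Γ : Type u} [Group Γ]

/-- The Hilbert space `ℓ²(Γ)`. -/
abbrev Ell2 (Γ : Type u) : Type u := lp (fun _ : Γ => ℂ) 2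

theorem memℓp_translate (g : Γ) (f : Ell2 Γ) :
    Memℓp (fun h : Γ => (f : Γ → ℂ) (g⁻¹ * h)) 2 := by
  have h := (lp.memℓp f).summable (p := 2) (by norm_num)
  exact memℓp_gen ((Equiv.mulLeft g⁻¹).summable_iff.mpr h)

/-- The left regular representation `(λ_g ψ)(h) = ψ(g⁻¹h)`. -/
noncomputable def leftRegular (g : Γ) : Ell2 Γ →L[ℂ] Ell2 Γ :=
  LinearIsometry.toContinuousLinearMap
    { toFun := fun f => ⟨fun h => (f : Γ → ℂ) (g⁻¹ * h), memℓp_translate g f⟩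
      map_add' := fun _ _ => rfl
      map_smul' := fun _ _ => rfl
      norm_map' := fun f => by
        rw [lp.norm_eq_tsum_rpow (by norm_num), lp.norm_eq_tsum_rpow (by norm_num)]
        congr 1
        exact (Equiv.mulLeft g⁻¹).tsum_eq
          (fun h => ‖(f : Γ → ℂ) h‖ ^ (2 : ENNReal).toReal) }

/-- For a subgroup `K` of `Γ`, the von Neumann algebra `L(K)`, realized on `ℓ²(Γ)` as the von
Neumann subalgebra of `L(Γ)` generated by the `λ_g` with `g ∈ K`. For `K = ⊤` this is `L(Γ)`. -/
noncomputable def groupVN (K : Subgroup Γ) : VonNeumannAlgebra (Ell2 Γ) :=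
  VNInclusion.generated (leftRegular '' (K : Set Γ))

/-- The vector `δ_1` of `ℓ²(Γ)`. -/
noncomputable def deltaOne (Γ : Type u) [Group Γ] : Ell2 Γ :=
  letI := Classical.decEq Γ
  lp.single 2 (1 : Γ) (1 : ℂ)

/-- The canonical trace `τ(x) = ⟨x δ_1, δ_1⟩` of `L(Γ)`. -/
noncomputable def trace (Γ : Type u) [Group Γ] :
    VNInclusion.Elem (groupVN (⊤ : Subgroup Γ)) →ₗ[ℂ] ℂ where
  toFun x := inner ℂ (deltaOne Γ) ((x : Ell2 Γ →L[ℂ] Ell2 Γ) (deltaOne Γ))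
  map_add' x y := by simp
  map_smul' c x := by simp

/-- `g` is a one-sided quasi-normalizer of the subgroup `K`: the right coset `K g` is covered by
finitely many left cosets of `K`. -/
def IsOneSidedQuasiNormalizer (K : Subgroup Γ) (g : Γ) : Prop :=
  ∃ s : Finset Γ, ∀ h ∈ K, ∃ t ∈ s, ∃ k ∈ K, h * g = t * k

end GroupVN

/-!
# Weak mixing of the Higman–Thompson factor in a Thompson-like group factor

All three assertions come from the one about one-sided quasi-normalizers, which is purely
group-theoretic.

*No quasi-normalizers* (`mem_of_isOneSidedQuasiNormalizer`). Let `g = [T, γ, U]` be such that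
`F_d g` is covered by `r` left cosets of `F_d`. All expansions `[T', γ', U']` of this triple
represent `g`. If two of them have the same number `M` of leaves but different labels `γ'`, then
they give different cosets `h g F_d` with `h ∈ F_d`, so the set `Y_M` of labels at level `M` has at
most `r` elements (`encard_expansionLabels_le`). Each cloning map `κ_j` maps `Y_M` injectively into
`Y_{M + d - 1}`. At a level `M` where `|Y_M|` is maximal every `κ_j` is therefore onto
`Y_{M + d - 1}`, which puts `Y_{M + d - 1}` into `⋂ j, Im κ_j`. For a diverse cloning system and
large `M` this intersection is trivial, hence `g` has an expansion with label `1`, that is,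
`g ∈ F_d`.

*From cosets to operators.* For a subgroup `K` without one-sided quasi-normalizers outside `K`,
B. H. Neumann's lemma on coset covers provides for every finite `A ⊆ Γ ∖ K` an `h ∈ K` with
`a h b ∉ K` for all `a, b ∈ A` (`exists_forall_mul_mul_notMem`). The conditional expectation of
`L(Γ)` onto `L(K)` restricts the Fourier coefficients of `x` to `K`. It is constructed as the
block-diagonal part of `x` with respect to the right cosets of `K`, which is bounded and positive
for trivial reasons; that it lies in the double commutant `L(K)` is a comparison of matrix
coefficients (`pinching_rightCoset_mem`). Finally `E(xuy) - E(x)uE(y) = E(x₀uy₀)` with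
`x₀ = x - E(x)` and `y₀ = y - E(y)`, and `‖E(x₀ λ_h y₀)‖₂` is small because `x₀` and `y₀` are
`‖·‖₂`-close to finite sums over `Γ ∖ K` (`exists_norm_restrict_lt`). So the unitaries `λ_h`,
indexed by the finite sets `A`, form the required net, and evaluating it far out gives weak mixing.
-/

/-! ### One-sided quasi-normalizers of the Higman–Thompson group -/

namespace ThompsonLike

namespace CloningSystem

variable {d : ℕ} {G : ℕ → Type u} [∀ n, Group (G n)] (S : CloningSystem d G)

theorem Steps.g_eq_one {x y : Triple d G} (h : S.Steps x y) (hy : y.g = 1) : x.g = 1 := by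
  induction h with
  | refl => exact hy
  | tail _ h2 ih =>
    obtain ⟨k, rfl⟩ := h2
    exact ih (S.kappa_injective _ k (hy.trans (S.kappa_one _ k).symm))

theorem cls_mem_higmanThompsonF {x : Triple d G} : S.cls x ∈ S.higmanThompsonF ↔ x.g = 1 := by
  refine ⟨?_, fun h => ⟨x, h, rfl⟩⟩
  rintro ⟨y, hy, hyx⟩
  obtain ⟨w, hw, hw'⟩ := S.exists_of_cls_eq hyx
  exact Steps.g_eq_one S hw' (Steps.one_of_one S hw hy)

/-- The elements of `G M` that occur as the middle entry of an expansion of the triple `x`, so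
that `[T, γ, U]` is another expression of the class of `x`. -/
def expansionLabels (x : Triple d G) (M : ℕ) : Set (G M) :=
  {γ | ∃ (T U : DTree d) (hT : T.leaves = M) (hU : U.leaves = M), S.Steps x ⟨M, T, U, hT, hU, γ⟩}

theorem kappa_mem_expansionLabels {x : Triple d G} {M : ℕ} (j : Fin M) {γ : G M}
    (h : γ ∈ S.expansionLabels x M) :
    S.kappa M j γ ∈ S.expansionLabels x (M + (d - 1)) := by
  obtain ⟨T, U, hT, hU, hs⟩ := h
  exact ⟨_, _, _, _, hs.tail ⟨j, rfl⟩⟩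

theorem exists_expansionLabels_nonempty (x : Triple d G) (n₀ : ℕ) :
    ∃ M, n₀ ≤ M ∧ (S.expansionLabels x M).Nonempty := by
  induction n₀ with
  | zero => exact ⟨x.n, Nat.zero_le _, x.g, x.T, x.U, x.hT, x.hU, .refl⟩
  | succ n ih =>
    obtain ⟨M, hM, γ, hγ⟩ := ih
    have hd := S.two_le
    have hpos : 0 < M := by
      obtain ⟨T, -, hT, -⟩ := hγ
      exact hT ▸ T.leaves_pos hd
    exact ⟨M + (d - 1), by omega, _, S.kappa_mem_expansionLabels ⟨0, hpos⟩ hγ⟩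

/-- Distinct labels `γ ≠ γ'` of expansions `[T, γ, U]` and `[T', γ', U']` of `g = [x]` with `M`
leaves give distinct left cosets `h g F_d ≠ h' g F_d`, where `h = [T₀, 1, T]` and
`h' = [T₀, 1, T']` carry `g` to `[T₀, γ, U]` and `[T₀, γ', U']`. -/
theorem encard_expansionLabels_le {x : Triple d G} {s : Finset S.Grp}
    (hs : ∀ h ∈ S.higmanThompsonF, ∃ t ∈ s, ∃ k ∈ S.higmanThompsonF, h * S.cls x = t * k) (M : ℕ) :
    (S.expansionLabels x M).encard ≤ s.card := by
  rcases (S.expansionLabels x M).eq_empty_or_nonempty with h0 | ⟨-, T₀, -, hT₀, -⟩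
  · simp [h0]
  have key : ∀ γ : G M, ∃ t : S.Grp, γ ∈ S.expansionLabels x M →
      t ∈ s ∧ ∃ (U : DTree d) (hU : U.leaves = M), ∃ k ∈ S.higmanThompsonF,
        S.cls ⟨M, T₀, U, hT₀, hU, γ⟩ = t * k := by
    intro γ
    by_cases hγ : γ ∈ S.expansionLabels x M
    · obtain ⟨T, U, hT, hU, hst⟩ := hγ
      obtain ⟨t, ht, k, hk, e⟩ := hs (S.cls ⟨M, T₀, T, hT₀, hT, 1⟩) ⟨_, rfl, rfl⟩
      refine ⟨t, fun _ => ⟨ht, U, hU, k, hk, ?_⟩⟩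
      rw [← e, S.cls_eq_of_steps hst, S.cls_mul (IsMul.mk M T₀ T U hT₀ hT hU 1 γ), one_mul]
    · exact ⟨1, fun h => (hγ h).elim⟩
  choose f hf using key
  rw [← Set.encard_coe_eq_coe_finsetCard]
  refine Set.encard_le_encard_of_injOn (f := f) (fun γ hγ => (hf γ hγ).1) ?_
  intro γ hγ γ' hγ' hff
  obtain ⟨-, U, hU, k, hk, e⟩ := hf γ hγ
  obtain ⟨-, U', hU', k', hk', e'⟩ := hf γ' hγ'
  have h1 : (S.cls ⟨M, T₀, U, hT₀, hU, γ⟩)⁻¹ * S.cls ⟨M, T₀, U', hT₀, hU', γ'⟩ ∈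
      S.higmanThompsonF := by
    rw [e, e', hff, mul_inv_rev, mul_assoc, inv_mul_cancel_left]
    exact mul_mem (inv_mem hk) hk'
  rw [S.cls_inv] at h1
  change S.cls ⟨M, U, T₀, hU, hT₀, γ⁻¹⟩ * _ ∈ _ at h1
  rw [S.cls_mul (IsMul.mk M U T₀ U' hU hT₀ hU' γ⁻¹ γ'), S.cls_mem_higmanThompsonF] at h1
  exact (inv_mul_eq_one.mp h1)

/-- The number of labels of expansions with `M` leaves is bounded, and nondecreasing along
`M ↦ M + (d - 1)` because each `κ_j` maps labels injectively to labels. Where this number is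
maximal, every `κ_j` is onto the labels of the next level, which therefore lie in
`⋂ j, Im κ_j = {1}`. -/
theorem mem_of_isOneSidedQuasiNormalizer (hS : S.IsDiverse) {g : S.Grp}
    (hg : GroupVN.IsOneSidedQuasiNormalizer S.higmanThompsonF g) : g ∈ S.higmanThompsonF := by
  obtain ⟨n₀, hn₀⟩ := hS
  obtain ⟨x, rfl⟩ : ∃ x, S.cls x = g := Quotient.exists_rep g
  obtain ⟨s, hs⟩ := hg
  have hfin : ∀ M, (S.expansionLabels x M).Finite := fun M =>
    Set.finite_of_encard_le_coe (S.encard_expansionLabels_le hs M)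
  let B : Set ℕ := {c | ∃ M, n₀ ≤ M ∧ (S.expansionLabels x M).Nonempty ∧
    (S.expansionLabels x M).ncard = c}
  have hB : B.Nonempty := by
    obtain ⟨M, hM, hne⟩ := S.exists_expansionLabels_nonempty x n₀
    exact ⟨_, M, hM, hne, rfl⟩
  have hBdd : BddAbove B := by
    refine ⟨s.card, ?_⟩
    rintro _ ⟨M, -, -, rfl⟩
    have h := S.encard_expansionLabels_le hs M
    rw [← (hfin M).cast_ncard_eq] at h
    exact_mod_cast h
  obtain ⟨M, hM, ⟨γ, hγ⟩, hc⟩ := Nat.sSup_mem hB hBdd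
  have hpos : 0 < M := by
    obtain ⟨T, -, hT, -⟩ := hγ
    exact hT ▸ T.leaves_pos S.two_le
  have hmem := S.kappa_mem_expansionLabels ⟨0, hpos⟩ hγ
  have honto : ∀ j : Fin M,
      S.kappa M j '' S.expansionLabels x M = S.expansionLabels x (M + (d - 1)) := by
    intro j
    refine Set.eq_of_subset_of_ncard_le ?_ ?_ (hfin _)
    · rintro _ ⟨δ, hδ, rfl⟩
      exact S.kappa_mem_expansionLabels j hδ
    · rw [Set.ncard_image_of_injective _ (S.kappa_injective M j), hc]
      exact le_csSup hBdd ⟨_, by omega, ⟨_, hmem⟩, rfl⟩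
  have hone : S.kappa M ⟨0, hpos⟩ γ = 1 := by
    have h : S.kappa M ⟨0, hpos⟩ γ ∈ ⋂ k : Fin M, Set.range (S.kappa M k) := by
      refine Set.mem_iInter.mpr fun j => ?_
      rw [← honto j] at hmem
      exact Set.image_subset_range _ _ hmem
    rw [hn₀ M hM] at h
    exact h
  rw [hone] at hmem
  obtain ⟨T, U, hT, hU, hst⟩ := hmem
  exact ⟨_, rfl, (S.cls_eq_of_steps hst).symm⟩

end CloningSystem

end ThompsonLike

/-! ### The mixing condition on cosets -/

namespace GroupVN

variable {Γ : Type u} [Group Γ]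

open scoped Pointwise in
/-- If `K` has no one-sided quasi-normalizers outside `K`, then the sets `{h ∈ K | a h b ∈ K}` with
`a, b ∉ K` are empty or left cosets of the subgroup `K ∩ b K b⁻¹`, which has infinite index in `K`.
By the lemma of B. H. Neumann on coset covers finitely many of them do not cover `K`. -/
theorem exists_forall_mul_mul_notMem {K : Subgroup Γ}
    (hK : ∀ g, IsOneSidedQuasiNormalizer K g → g ∈ K) (A : Finset Γ) (hA : ∀ a ∈ A, a ∉ K) :
    ∃ h ∈ K, ∀ a ∈ A, ∀ b ∈ A, a * h * b ∉ K := by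
  classical
  by_contra! hcon
  let H : Γ × Γ → Subgroup K := fun p =>
    (K.comap (MulAut.conj p.2⁻¹).toMonoidHom).subgroupOf K
  have memH : ∀ (p : Γ × Γ) (k : K), k ∈ H p ↔ p.2⁻¹ * k * p.2 ∈ K := by
    intro p k
    simp [H, Subgroup.mem_subgroupOf]
  have key : ∀ p : Γ × Γ, ∃ h₀ : K, (∃ h : K, p.1 * h * p.2 ∈ K) → p.1 * h₀ * p.2 ∈ K := by
    intro p
    by_cases h : ∃ h : K, p.1 * h * p.2 ∈ K
    · exact ⟨h.choose, fun _ => h.choose_spec⟩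
    · exact ⟨1, fun h' => (h h').elim⟩
  choose f hf using key
  have hcover : ⋃ p ∈ A ×ˢ A, f p • (H p : Set K) = Set.univ := by
    refine Set.eq_univ_of_forall fun h => ?_
    obtain ⟨a, ha, b, hb, hab⟩ := hcon h h.2
    refine Set.mem_biUnion (x := (a, b)) (by simp [ha, hb]) ?_
    rw [mem_leftCoset_iff, SetLike.mem_coe, memH]
    have h1 := mul_mem (inv_mem (hf (a, b) ⟨h, hab⟩)) hab
    simpa [mul_assoc] using h1
  obtain ⟨⟨a, b⟩, hp, hfi⟩ := Subgroup.exists_finiteIndex_of_leftCoset_cover hcover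
  have hb : b ∈ A := (Finset.mem_product.mp hp).2
  refine hA b hb (hK b ?_)
  have : Fintype (K ⧸ H (a, b)) := Fintype.ofFinite _
  refine ⟨Finset.univ.image fun q : K ⧸ H (a, b) => (q.out : Γ) * b, fun h hh => ?_⟩
  let q : K ⧸ H (a, b) := QuotientGroup.mk ⟨h, hh⟩
  have hq : q.out⁻¹ * ⟨h, hh⟩ ∈ H (a, b) := QuotientGroup.eq.mp q.out_eq
  refine ⟨_, Finset.mem_image_of_mem _ (Finset.mem_univ q), _, (memH _ _).mp hq, ?_⟩
  simp [mul_assoc]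

end GroupVN

/-! ### Restrictions and pinchings on `ℓ²(Γ)` -/

namespace GroupVN

/-- The orthogonal projection of `ℓ²(Γ)` onto the functions supported in `s`. -/
noncomputable def restrict {Γ : Type u} (s : Set Γ) : Ell2 Γ →L[ℂ] Ell2 Γ :=
  LinearMap.mkContinuous
    { toFun := fun f => ⟨s.indicator f, (lp.memℓp f).mono' fun _ => norm_indicator_le_norm_self _ _⟩
      map_add' := fun f g => Subtype.ext (Set.indicator_add s f g)
      map_smul' := fun c f => Subtype.ext (Set.indicator_const_smul s c f) } 1 fun f => by
    rw [one_mul]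
    exact lp.norm_mono (by norm_num) fun _ => norm_indicator_le_norm_self _ _

section

variable {Γ : Type u} {Q : Type*}

theorem restrict_apply (s : Set Γ) (f : Ell2 Γ) : (restrict s f : Γ → ℂ) = s.indicator f := rfl

theorem norm_restrict_le (s : Set Γ) (f : Ell2 Γ) : ‖restrict s f‖ ≤ ‖f‖ :=
  lp.norm_mono (by norm_num) fun _ => norm_indicator_le_norm_self _ _

theorem hasSum_norm_sq (f : Ell2 Γ) : HasSum (fun g => ‖f g‖ ^ 2) (‖f‖ ^ 2) := by
  simpa using lp.hasSum_norm (p := 2) (by norm_num) f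

theorem sum_norm_sq_le (f : Ell2 Γ) (s : Finset Γ) : ∑ g ∈ s, ‖f g‖ ^ 2 ≤ ‖f‖ ^ 2 :=
  sum_le_hasSum s (fun _ _ => by positivity) (hasSum_norm_sq f)

theorem norm_le_of_sum_norm_sq_le {f : Ell2 Γ} {C : ℝ} (hC : 0 ≤ C)
    (h : ∀ s : Finset Γ, ∑ g ∈ s, ‖f g‖ ^ 2 ≤ C ^ 2) : ‖f‖ ≤ C :=
  lp.norm_le_of_forall_sum_le (by norm_num) hC (by simpa using h)

/-- The components of a vector on the fibres of a map `π` are orthogonal. -/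
theorem sum_norm_sq_restrict_fiber_le (π : Γ → Q) (f : Ell2 Γ) (t : Finset Q) :
    ∑ q ∈ t, ‖restrict (π ⁻¹' {q}) f‖ ^ 2 ≤ ‖f‖ ^ 2 := by
  classical
  refine hasSum_le ?_ (hasSum_sum fun q _ => hasSum_norm_sq (restrict (π ⁻¹' {q}) f))
    (hasSum_norm_sq f)
  intro g
  have h : ∀ q ∈ t, ‖restrict (π ⁻¹' {q}) f g‖ ^ 2 = if π g = q then ‖f g‖ ^ 2 else 0 := by
    intro q _
    rw [restrict_apply, Set.indicator_apply]
    by_cases hq : π g = q <;> simp [hq]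
  rw [Finset.sum_congr rfl h, Finset.sum_ite_eq]
  split_ifs
  · exact le_rfl
  · positivity

/-- The value of the pinching of `x` at `f` has norm at most `‖x‖ ‖f‖`: on each fibre it is a
part of the value of `x` at the component of `f` on that fibre. -/
theorem sum_norm_sq_pinching_le (π : Γ → Q) (x : Ell2 Γ →L[ℂ] Ell2 Γ) (f : Ell2 Γ) (s : Finset Γ) :
    ∑ g ∈ s, ‖x (restrict (π ⁻¹' {π g}) f) g‖ ^ 2 ≤ (‖x‖ * ‖f‖) ^ 2 := by
  classical
  calc ∑ g ∈ s, ‖x (restrict (π ⁻¹' {π g}) f) g‖ ^ 2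
      = ∑ q ∈ s.image π, ∑ g ∈ s with π g = q, ‖x (restrict (π ⁻¹' {π g}) f) g‖ ^ 2 :=
        (Finset.sum_fiberwise_of_maps_to (fun g hg => Finset.mem_image_of_mem π hg) _).symm
    _ ≤ ∑ q ∈ s.image π, ‖x‖ ^ 2 * ‖restrict (π ⁻¹' {q}) f‖ ^ 2 := by
        refine Finset.sum_le_sum fun q _ => ?_
        have h : ∑ g ∈ s with π g = q, ‖x (restrict (π ⁻¹' {π g}) f) g‖ ^ 2 =
            ∑ g ∈ s with π g = q, ‖x (restrict (π ⁻¹' {q}) f) g‖ ^ 2 := by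
          refine Finset.sum_congr rfl fun g hg => ?_
          rw [(Finset.mem_filter.mp hg).2]
        rw [h, ← mul_pow]
        refine (sum_norm_sq_le _ _).trans ?_
        gcongr
        exact x.le_opNorm _
    _ ≤ (‖x‖ * ‖f‖) ^ 2 := by
        rw [← Finset.mul_sum, mul_pow]
        gcongr
        exact sum_norm_sq_restrict_fiber_le π f _

/-- The pinching of an operator `x` on `ℓ²(Γ)` along a map `π`, that is, the sum of the diagonal
blocks `P_q x P_q`, where `P_q` is the projection onto the functions supported in the fibre
`π⁻¹(q)`. -/
noncomputable def pinching (π : Γ → Q) (x : Ell2 Γ →L[ℂ] Ell2 Γ) : Ell2 Γ →L[ℂ] Ell2 Γ :=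
  LinearMap.mkContinuous
    { toFun := fun f => ⟨fun g => x (restrict (π ⁻¹' {π g}) f) g,
        memℓp_gen' (C := (‖x‖ * ‖f‖) ^ 2) (by simpa using sum_norm_sq_pinching_le π x f)⟩
      map_add' := fun f f' => Subtype.ext <| funext fun g => by
        simp only [map_add]; rfl
      map_smul' := fun c f => Subtype.ext <| funext fun g => by
        simp only [map_smul]; rfl } ‖x‖ fun f =>
    norm_le_of_sum_norm_sq_le (by positivity) (sum_norm_sq_pinching_le π x f)

theorem pinching_apply (π : Γ → Q) (x : Ell2 Γ →L[ℂ] Ell2 Γ) (f : Ell2 Γ) (g : Γ) :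
    pinching π x f g = x (restrict (π ⁻¹' {π g}) f) g := rfl

theorem restrict_apply_of_mem {s : Set Γ} {g : Γ} (hg : g ∈ s) (f : Ell2 Γ) :
    restrict s f g = f g := by
  rw [restrict_apply, Set.indicator_of_mem hg]

theorem restrict_apply_of_notMem {s : Set Γ} {g : Γ} (hg : g ∉ s) (f : Ell2 Γ) :
    restrict s f g = 0 := by
  rw [restrict_apply, Set.indicator_of_notMem hg]

theorem restrict_fiber_pinching (π : Γ → Q) (x : Ell2 Γ →L[ℂ] Ell2 Γ) (f : Ell2 Γ) (q : Q) :
    restrict (π ⁻¹' {q}) (pinching π x f) =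
      restrict (π ⁻¹' {q}) (x (restrict (π ⁻¹' {q}) f)) := by
  ext g
  by_cases hg : g ∈ π ⁻¹' {q}
  · rw [restrict_apply_of_mem hg, restrict_apply_of_mem hg, pinching_apply, show π g = q from hg]
  · rw [restrict_apply_of_notMem hg, restrict_apply_of_notMem hg]

theorem pinching_eq_self {π : Γ → Q} {x : Ell2 Γ →L[ℂ] Ell2 Γ}
    (hx : ∀ q f, x (restrict (π ⁻¹' {q}) f) = restrict (π ⁻¹' {q}) (x f)) : pinching π x = x := by
  ext f g
  rw [pinching_apply, hx, restrict_apply_of_mem (by rfl)]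

theorem pinching_mul_mul {π : Γ → Q} {a b : Ell2 Γ →L[ℂ] Ell2 Γ} (x : Ell2 Γ →L[ℂ] Ell2 Γ)
    (ha : ∀ q f, a (restrict (π ⁻¹' {q}) f) = restrict (π ⁻¹' {q}) (a f))
    (hb : ∀ q f, b (restrict (π ⁻¹' {q}) f) = restrict (π ⁻¹' {q}) (b f)) :
    pinching π (a * x * b) = a * pinching π x * b := by
  ext f g
  have h : ∀ f', a f' g = a (restrict (π ⁻¹' {π g}) f') g := fun f' => by
    rw [ha, restrict_apply_of_mem (by rfl)]
  change a (x (b (restrict (π ⁻¹' {π g}) f))) g = a (pinching π x (b f)) g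
  rw [h (pinching π x (b f)), restrict_fiber_pinching, ← h, hb]

theorem hasSum_inner_pinching (π : Γ → Q) (x : Ell2 Γ →L[ℂ] Ell2 Γ) (f : Ell2 Γ) :
    HasSum (fun q => (inner ℂ (x (restrict (π ⁻¹' {q}) f)) (restrict (π ⁻¹' {q}) f) : ℂ))
      (inner ℂ (pinching π x f) f) := by
  have h := (Equiv.sigmaFiberEquiv π).hasSum_iff.mpr (lp.hasSum_inner (𝕜 := ℂ) (pinching π x f) f)
  refine h.sigma fun q => ?_
  have h1 := lp.hasSum_inner (𝕜 := ℂ) (x (restrict (π ⁻¹' {q}) f)) (restrict (π ⁻¹' {q}) f)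
  rw [← hasSum_subtype_iff_of_support_subset (s := π ⁻¹' {q})] at h1
  · refine (congrArg (fun F : {g // π g = q} → ℂ => HasSum F _) (funext ?_)).mp h1
    rintro ⟨g, hgq⟩
    have hg : g ∈ π ⁻¹' {q} := hgq
    change inner ℂ (x (restrict (π ⁻¹' {q}) f) g) (restrict (π ⁻¹' {q}) f g) =
      inner ℂ (pinching π x f g) (f g)
    rw [restrict_apply_of_mem hg, pinching_apply, hgq]
  · intro g hg
    by_contra hgq
    exact hg (by simp only [restrict_apply_of_notMem hgq, inner_zero_right])

theorem isPositive_pinching (π : Γ → Q) {x : Ell2 Γ →L[ℂ] Ell2 Γ} (hx : x.IsPositive) :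
    (pinching π x).IsPositive := by
  rw [ContinuousLinearMap.isPositive_iff_complex] at hx ⊢
  intro f
  have h := hasSum_inner_pinching π x f
  have hre := (Complex.hasSum_iff _ _).mp h
  refine ⟨?_, hre.1.nonneg fun q => (hx _).2⟩
  have him : (inner ℂ (pinching π x f) f : ℂ).im = 0 := by
    refine hre.2.unique ?_
    convert hasSum_zero using 1
    funext q
    rw [← (hx (restrict (π ⁻¹' {q}) f)).1]
    exact Complex.ofReal_im _
  exact Complex.ext (by simp) (by simp [him])

theorem pinching_add (π : Γ → Q) (x y : Ell2 Γ →L[ℂ] Ell2 Γ) :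
    pinching π (x + y) = pinching π x + pinching π y := by
  ext f g
  simp [pinching_apply]

theorem pinching_smul (π : Γ → Q) (c : ℂ) (x : Ell2 Γ →L[ℂ] Ell2 Γ) :
    pinching π (c • x) = c • pinching π x := by
  ext f g
  simp [pinching_apply]

end

end GroupVN

/-! ### Group von Neumann algebras as double commutants -/

namespace GroupVN

section

variable {Γ : Type u}

/-- The vector `δ_g` of `ℓ²(Γ)`. -/
noncomputable def delta (g : Γ) : Ell2 Γ :=
  letI := Classical.decEq Γ
  lp.single 2 g (1 : ℂ)

theorem delta_self (g : Γ) : delta g g = 1 :=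
  letI := Classical.decEq Γ
  lp.single_apply_self _ _ _

theorem delta_of_ne {g h : Γ} (hgh : h ≠ g) : delta g h = 0 :=
  letI := Classical.decEq Γ
  lp.single_apply_ne _ _ _ hgh

theorem restrict_delta_of_mem {s : Set Γ} {g : Γ} (hg : g ∈ s) :
    restrict s (delta g) = delta g := by
  ext h
  by_cases hh : h ∈ s
  · rw [restrict_apply_of_mem hh]
  · rw [restrict_apply_of_notMem hh, delta_of_ne]
    rintro rfl
    exact hh hg

theorem restrict_delta_of_notMem {s : Set Γ} {g : Γ} (hg : g ∉ s) : restrict s (delta g) = 0 := by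
  ext h
  by_cases hh : h ∈ s
  · rw [restrict_apply_of_mem hh, delta_of_ne]
    · rfl
    · rintro rfl
      exact hg hh
  · rw [restrict_apply_of_notMem hh]
    rfl

theorem hasSum_smul_delta (f : Ell2 Γ) : HasSum (fun g => f g • delta g) f := by
  classical
  convert lp.hasSum_single (p := 2) (by norm_num) f using 2 with g
  ext k
  by_cases hk : k = g
  · subst hk
    simp [delta_self]
  · simp [delta_of_ne hk, hk]

/-- The matrix expansion of an operator on `ℓ²(Γ)`. -/
theorem hasSum_mul_apply_delta (T : Ell2 Γ →L[ℂ] Ell2 Γ) (f : Ell2 Γ) (a : Γ) :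
    HasSum (fun c => f c * T (delta c) a) (T f a) := by
  have h := (hasSum_smul_delta f).mapL ((lp.evalCLM ℂ (fun _ : Γ => ℂ) 2 a).comp T)
  refine Eq.mp (congrArg (fun F : Γ → ℂ => HasSum F (T f a)) (funext fun c => ?_)) h
  change T (f c • delta c) a = _
  rw [map_smul]
  rfl

variable [Group Γ]

theorem leftRegular_apply (g : Γ) (f : Ell2 Γ) (h : Γ) : leftRegular g f h = f (g⁻¹ * h) := rfl

theorem leftRegular_mul (g h : Γ) : leftRegular g * leftRegular h = leftRegular (g * h) := by
  ext f k
  change f (h⁻¹ * (g⁻¹ * k)) = f ((g * h)⁻¹ * k)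
  rw [mul_inv_rev, mul_assoc]

theorem leftRegular_one : leftRegular (1 : Γ) = 1 := by
  ext f k
  change f (1⁻¹ * k) = f k
  rw [inv_one, one_mul]

theorem star_leftRegular (g : Γ) : star (leftRegular g) = leftRegular g⁻¹ := by
  rw [ContinuousLinearMap.star_eq_adjoint]
  refine ((ContinuousLinearMap.eq_adjoint_iff _ _).mpr fun f f' => ?_).symm
  rw [lp.inner_eq_tsum, lp.inner_eq_tsum]
  refine Eq.trans (tsum_congr fun h => ?_)
    ((Equiv.mulLeft g).tsum_eq fun h => inner ℂ (f h) (leftRegular g f' h))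
  simp [leftRegular_apply]

theorem norm_leftRegular (g : Γ) (f : Ell2 Γ) : ‖leftRegular g f‖ = ‖f‖ := by
  unfold leftRegular
  rw [LinearIsometry.coe_toContinuousLinearMap, LinearIsometry.norm_map]

/-- The right translation `(ρ_g ψ)(h) = ψ(hg)`. -/
noncomputable def rightRegular (g : Γ) : Ell2 Γ →L[ℂ] Ell2 Γ :=
  LinearIsometry.toContinuousLinearMap
    { toFun := fun f => ⟨fun h => (f : Γ → ℂ) (h * g), memℓp_gen
        ((Equiv.mulRight g).summable_iff.mpr ((lp.memℓp f).summable (by norm_num)))⟩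
      map_add' := fun _ _ => rfl
      map_smul' := fun _ _ => rfl
      norm_map' := fun f => by
        rw [lp.norm_eq_tsum_rpow (by norm_num), lp.norm_eq_tsum_rpow (by norm_num)]
        congr 1
        exact (Equiv.mulRight g).tsum_eq
          (fun h => ‖(f : Γ → ℂ) h‖ ^ (2 : ENNReal).toReal) }

theorem rightRegular_apply (g : Γ) (f : Ell2 Γ) (h : Γ) : rightRegular g f h = f (h * g) := rfl

theorem norm_rightRegular (g : Γ) (f : Ell2 Γ) : ‖rightRegular g f‖ = ‖f‖ := by
  unfold rightRegular
  rw [LinearIsometry.coe_toContinuousLinearMap, LinearIsometry.norm_map]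

theorem delta_one : delta (1 : Γ) = deltaOne Γ := rfl

theorem leftRegular_delta (g h : Γ) : leftRegular g (delta h) = delta (g * h) := by
  ext k
  rw [leftRegular_apply]
  by_cases hk : k = g * h
  · rw [hk, inv_mul_cancel_left, delta_self, delta_self]
  · rw [delta_of_ne hk, delta_of_ne]
    rintro rfl
    simp at hk

theorem rightRegular_delta (g h : Γ) : rightRegular g (delta h) = delta (h * g⁻¹) := by
  ext k
  rw [rightRegular_apply]
  by_cases hk : k = h * g⁻¹
  · rw [hk, inv_mul_cancel_right, delta_self, delta_self]
  · rw [delta_of_ne hk, delta_of_ne]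
    rintro rfl
    simp at hk

theorem mem_groupVN_iff {K : Subgroup Γ} {x : Ell2 Γ →L[ℂ] Ell2 Γ} :
    x ∈ groupVN K ↔
      ∀ T : Ell2 Γ →L[ℂ] Ell2 Γ, (∀ k ∈ K, leftRegular k * T = T * leftRegular k) →
        T * x = x * T := by
  have hc : ∀ T : Ell2 Γ →L[ℂ] Ell2 Γ,
      T ∈ StarSubalgebra.centralizer ℂ (leftRegular '' (K : Set Γ)) ↔
        ∀ k ∈ K, leftRegular k * T = T * leftRegular k := by
    intro T
    rw [StarSubalgebra.mem_centralizer_iff]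
    constructor
    · exact fun h k hk => (h _ ⟨k, hk, rfl⟩).1
    · rintro h _ ⟨k, hk, rfl⟩
      refine ⟨h k hk, ?_⟩
      rw [star_leftRegular]
      exact h _ (inv_mem hk)
  change x ∈ StarSubalgebra.centralizer ℂ (StarSubalgebra.centralizer ℂ
    (leftRegular '' (K : Set Γ)) : Set (Ell2 Γ →L[ℂ] Ell2 Γ)) ↔ _
  rw [StarSubalgebra.mem_centralizer_iff]
  constructor
  · exact fun h T hT => (h T ((hc T).mpr hT)).1
  · intro h T hT
    exact ⟨h T ((hc T).mp hT), h _ ((hc _).mp (star_mem hT))⟩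

theorem groupVN_mono {K K' : Subgroup Γ} (h : K ≤ K') : groupVN K ≤ groupVN K' := fun _ hx =>
  mem_groupVN_iff.mpr fun T hT => mem_groupVN_iff.mp hx T fun k hk => hT k (h hk)

theorem leftRegular_mem_groupVN {K : Subgroup Γ} {k : Γ} (hk : k ∈ K) :
    leftRegular k ∈ groupVN K :=
  mem_groupVN_iff.mpr fun _ hT => (hT k hk).symm

/-- Elements of `L(Γ)` are determined by their value at `δ_1`, because they commute with right
translations. -/
theorem apply_delta {x : Ell2 Γ →L[ℂ] Ell2 Γ} (hx : x ∈ groupVN (⊤ : Subgroup Γ)) (c : Γ) :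
    x (delta c) = rightRegular c⁻¹ (x (deltaOne Γ)) := by
  have h := mem_groupVN_iff.mp hx (rightRegular c⁻¹) fun k _ => by
    ext f g
    change f (k⁻¹ * g * c⁻¹) = f (k⁻¹ * (g * c⁻¹))
    rw [mul_assoc]
  have h1 := DFunLike.congr_fun h (deltaOne Γ)
  change rightRegular c⁻¹ (x (deltaOne Γ)) = x (rightRegular c⁻¹ (deltaOne Γ)) at h1
  rw [h1, ← delta_one, rightRegular_delta, one_mul, inv_inv]

/-! ### The conditional expectation onto the von Neumann algebra of a subgroup -/

/-- The right coset `K g`. -/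
def rightCoset (K : Subgroup Γ) (g : Γ) : Quotient (QuotientGroup.rightRel K) := Quotient.mk'' g

theorem rightCoset_eq {K : Subgroup Γ} {g h : Γ} :
    rightCoset K g = rightCoset K h ↔ h * g⁻¹ ∈ K :=
  Quotient.eq''.trans QuotientGroup.rightRel_apply

theorem apply_restrict_rightCoset {K : Subgroup Γ} {a : Ell2 Γ →L[ℂ] Ell2 Γ} (ha : a ∈ groupVN K)
    (q : Quotient (QuotientGroup.rightRel K)) (f : Ell2 Γ) :
    a (restrict (rightCoset K ⁻¹' {q}) f) = restrict (rightCoset K ⁻¹' {q}) (a f) := by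
  have h := mem_groupVN_iff.mp ha (restrict (rightCoset K ⁻¹' {q})) fun k hk => by
    ext f g
    have hg : k⁻¹ * g ∈ rightCoset K ⁻¹' {q} ↔ g ∈ rightCoset K ⁻¹' {q} := by
      have : rightCoset K (k⁻¹ * g) = rightCoset K g := by
        rw [rightCoset_eq]
        simpa using hk
      simp only [Set.mem_preimage, this]
    change restrict _ f (k⁻¹ * g) = restrict _ (leftRegular k f) g
    by_cases hg' : g ∈ rightCoset K ⁻¹' {q}
    · rw [restrict_apply_of_mem hg', restrict_apply_of_mem (hg.mpr hg'), leftRegular_apply]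
    · rw [restrict_apply_of_notMem hg', restrict_apply_of_notMem (mt hg.mp hg')]
  exact (DFunLike.congr_fun h f).symm

theorem pinching_rightCoset_delta (K : Subgroup Γ) (x : Ell2 Γ →L[ℂ] Ell2 Γ) (b c : Γ) :
    pinching (rightCoset K) x (delta b) c =
      {g | g * b⁻¹ ∈ K}.indicator (x (delta b)) c := by
  rw [pinching_apply]
  by_cases hc : c * b⁻¹ ∈ K
  · have h : restrict (rightCoset K ⁻¹' {rightCoset K c}) (delta b) = delta b :=
      restrict_delta_of_mem (rightCoset_eq.mpr hc)
    rw [h, Set.indicator_of_mem (by exact hc)]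
  · have h : restrict (rightCoset K ⁻¹' {rightCoset K c}) (delta b) = 0 :=
      restrict_delta_of_notMem fun h => hc (rightCoset_eq.mp h)
    rw [h, Set.indicator_of_notMem (by exact hc), map_zero]
    rfl

theorem pinching_rightCoset_deltaOne (K : Subgroup Γ) (x : Ell2 Γ →L[ℂ] Ell2 Γ) :
    pinching (rightCoset K) x (deltaOne Γ) = restrict (K : Set Γ) (x (deltaOne Γ)) := by
  ext c
  have h := pinching_rightCoset_delta K x 1 c
  simp only [inv_one, mul_one] at h
  exact h

/-- For `T` in the commutant of `λ(K)` and `ξ = x δ_1`, both `⟨T E(x) δ_b, δ_a⟩` and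
`⟨E(x) T δ_b, δ_a⟩` are equal to `∑_{m ∈ K} ξ(m) (T δ_b)(m⁻¹ a)`. -/
theorem pinching_rightCoset_mem {K : Subgroup Γ} {x : Ell2 Γ →L[ℂ] Ell2 Γ}
    (hx : x ∈ groupVN (⊤ : Subgroup Γ)) : pinching (rightCoset K) x ∈ groupVN K := by
  refine mem_groupVN_iff.mpr fun T hT => ?_
  have key : ∀ a b : Γ, T (pinching (rightCoset K) x (delta b)) a =
      pinching (rightCoset K) x (T (delta b)) a := by
    intro a b
    have h1 := hasSum_mul_apply_delta T (pinching (rightCoset K) x (delta b)) a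
    -- Both matrix expansions are indexed by `m`: the first by `c = m b`, the second by `c = m⁻¹ a`.
    rw [← (Equiv.mulRight b).hasSum_iff] at h1
    have h2 := hasSum_mul_apply_delta x
      (restrict (rightCoset K ⁻¹' {rightCoset K a}) (T (delta b))) a
    rw [← ((Equiv.inv Γ).trans (Equiv.mulRight a)).hasSum_iff] at h2
    rw [pinching_apply]
    refine h1.unique ?_
    convert h2 using 1
    funext m
    change pinching (rightCoset K) x (delta b) (m * b) * T (delta (m * b)) a =
      restrict _ (T (delta b)) (m⁻¹ * a) * x (delta (m⁻¹ * a)) a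
    rw [pinching_rightCoset_delta]
    by_cases hm : m ∈ K
    · have hTm : T (delta (m * b)) a = T (delta b) (m⁻¹ * a) := by
        have h3 := DFunLike.congr_fun (hT m hm) (delta b)
        change leftRegular m (T (delta b)) = T (leftRegular m (delta b)) at h3
        rw [← leftRegular_delta, ← h3, leftRegular_apply]
      rw [Set.indicator_of_mem (by simpa using hm), restrict_apply_of_mem, hTm, apply_delta hx,
        apply_delta hx, rightRegular_apply, rightRegular_apply, mul_comm]
      · simp
      · exact rightCoset_eq.mpr (by simpa using hm)
    · rw [Set.indicator_of_notMem (by simpa using hm), restrict_apply_of_notMem, zero_mul, zero_mul]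
      exact fun h => hm (by simpa using rightCoset_eq.mp h)
  refine ContinuousLinearMap.ext fun f => ?_
  ext a
  refine (hasSum_mul_apply_delta (T * pinching (rightCoset K) x) f a).unique ?_
  convert hasSum_mul_apply_delta (pinching (rightCoset K) x * T) f a using 1
  funext c
  exact congrArg (f c * ·) (key a c)

/-- The conditional expectation of `L(Γ)` onto `L(K)`: if `x` is the left convolution by
`ξ = x δ_1`, then `E(x)` is the left convolution by the restriction of `ξ` to `K`. It is realized
as the pinching of `x` along the partition of `Γ` into the right cosets of `K`. -/
noncomputable def condExp (K : Subgroup Γ) :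
    VNInclusion.Elem (groupVN (⊤ : Subgroup Γ)) →ₗ[ℂ]
      VNInclusion.Elem (groupVN (⊤ : Subgroup Γ)) where
  toFun x := ⟨pinching (rightCoset K) x, groupVN_mono le_top (pinching_rightCoset_mem x.2)⟩
  map_add' _ _ := Subtype.ext (pinching_add _ _ _)
  map_smul' _ _ := Subtype.ext (pinching_smul _ _ _)

theorem condExp_deltaOne (K : Subgroup Γ) (x : VNInclusion.Elem (groupVN (⊤ : Subgroup Γ))) :
    (condExp K x : Ell2 Γ →L[ℂ] Ell2 Γ) (deltaOne Γ) =
      restrict (K : Set Γ) ((x : Ell2 Γ →L[ℂ] Ell2 Γ) (deltaOne Γ)) :=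
  pinching_rightCoset_deltaOne K x

theorem inner_deltaOne (f : Ell2 Γ) : (inner ℂ (deltaOne Γ) f : ℂ) = f 1 := by
  classical
  have h := lp.inner_single_left (𝕜 := ℂ) (G := fun _ : Γ => ℂ) (1 : Γ) 1 f
  rw [show deltaOne Γ = lp.single 2 (1 : Γ) (1 : ℂ) by unfold deltaOne; congr]
  simpa using h

theorem isCondExp_condExp (K : Subgroup Γ) :
    VNInclusion.IsCondExp (groupVN K) (groupVN (⊤ : Subgroup Γ)) (trace Γ) (condExp K) where
  le := groupVN_mono le_top
  mem x := pinching_rightCoset_mem x.2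
  eq_self x hx := Subtype.ext (pinching_eq_self (apply_restrict_rightCoset hx))
  bimodule a x b ha hb := Subtype.ext (pinching_mul_mul _ (apply_restrict_rightCoset ha)
    (apply_restrict_rightCoset hb))
  positive x hx := isPositive_pinching _ hx
  trace x := by
    change inner ℂ (deltaOne Γ) ((condExp K x : Ell2 Γ →L[ℂ] Ell2 Γ) (deltaOne Γ)) =
      inner ℂ (deltaOne Γ) ((x : Ell2 Γ →L[ℂ] Ell2 Γ) (deltaOne Γ))
    rw [condExp_deltaOne, inner_deltaOne, inner_deltaOne, restrict_apply_of_mem (one_mem K)]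

theorem twoNorm_trace (x : VNInclusion.Elem (groupVN (⊤ : Subgroup Γ))) :
    VNInclusion.twoNorm (trace Γ) x = ‖(x : Ell2 Γ →L[ℂ] Ell2 Γ) (deltaOne Γ)‖ := by
  have h : trace Γ (star x * x) = inner ℂ ((x : Ell2 Γ →L[ℂ] Ell2 Γ) (deltaOne Γ))
      ((x : Ell2 Γ →L[ℂ] Ell2 Γ) (deltaOne Γ)) :=
    ContinuousLinearMap.adjoint_inner_right (x : Ell2 Γ →L[ℂ] Ell2 Γ) _ _
  rw [VNInclusion.twoNorm, h, norm_eq_sqrt_re_inner (𝕜 := ℂ)]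
  rfl

end

end GroupVN

/-! ### Weak mixing from the mixing condition on cosets -/

namespace GroupVN

open Filter Topology

variable {Γ : Type u}

theorem exists_norm_sub_sum_smul_delta_lt (f : Ell2 Γ) {ε : ℝ} (hε : 0 < ε) :
    ∃ A : Finset Γ, (∀ a ∈ A, f a ≠ 0) ∧ ‖f - ∑ a ∈ A, f a • delta a‖ < ε := by
  classical
  obtain ⟨A, hA⟩ := ((Metric.tendsto_nhds.mp (hasSum_smul_delta f)) ε hε).exists
  refine ⟨A.filter fun a => f a ≠ 0, fun a ha => (Finset.mem_filter.mp ha).2, ?_⟩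
  rw [Finset.sum_filter_of_ne, ← dist_eq_norm, dist_comm]
  · exact hA
  · intro a _ ha h
    rw [h, zero_smul] at ha
    exact ha rfl

theorem sum_smul_delta_apply_of_notMem {f : Γ → ℂ} {A : Finset Γ} {g : Γ} (hg : g ∉ A) :
    (∑ a ∈ A, f a • delta a : Ell2 Γ) g = 0 := by
  rw [lp.coeFn_sum, Finset.sum_apply]
  refine Finset.sum_eq_zero fun a ha => ?_
  have hga : g ≠ a := fun h => hg (h.symm ▸ ha)
  change f a • delta a g = 0
  rw [delta_of_ne hga, smul_zero]

/-- Let `T` have norm at most `C`. If `f` is `‖·‖`-close to its restriction to a finite set `B`,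
relative to `C`, and the norms of the vectors `T δ_b` with `b ∈ B` are small, relative to the
values of `f` on `B`, then the norm of `T f` is small. -/
theorem norm_apply_lt_of_norm_apply_delta_le {T : Ell2 Γ →L[ℂ] Ell2 Γ} {C : ℝ} (hC : 0 ≤ C)
    (hT : ∀ f, ‖T f‖ ≤ C * ‖f‖) {f : Ell2 Γ} {B : Finset Γ} {ε : ℝ} (hε : 0 < ε)
    (hf : ‖f - ∑ b ∈ B, f b • delta b‖ < ε / (2 * (C + 1)))
    (hB : ∀ b ∈ B, ‖T (delta b)‖ ≤ ε / (2 * (∑ b ∈ B, ‖f b‖ + 1))) : ‖T f‖ < ε := by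
  have hsplit : T f = T (f - ∑ b ∈ B, f b • delta b) + ∑ b ∈ B, f b • T (delta b) := by
    rw [map_sub, map_sum]
    simp only [map_smul, sub_add_cancel]
  have h1 : ‖T (f - ∑ b ∈ B, f b • delta b)‖ ≤ ε / 2 := by
    generalize f - ∑ b ∈ B, f b • delta b = v at hf
    calc ‖T v‖ ≤ C * ‖v‖ := hT v
      _ ≤ C * (ε / (2 * (C + 1))) := mul_le_mul_of_nonneg_left hf.le hC
      _ ≤ (C + 1) * (ε / (2 * (C + 1))) := by gcongr; linarith
      _ = ε / 2 := by field_simp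
  have hsum : 0 ≤ ∑ b ∈ B, ‖f b‖ := Finset.sum_nonneg fun b _ => norm_nonneg _
  have h2 : ‖∑ b ∈ B, f b • T (delta b)‖ < ε / 2 := by
    have h3 : ‖∑ b ∈ B, f b • T (delta b)‖ ≤
        (∑ b ∈ B, ‖f b‖) * (ε / (2 * (∑ b ∈ B, ‖f b‖ + 1))) := by
      rw [Finset.sum_mul]
      refine norm_sum_le_of_le _ fun b hb => ?_
      rw [norm_smul]
      exact mul_le_mul_of_nonneg_left (hB b hb) (norm_nonneg _)
    generalize ∑ b ∈ B, ‖f b‖ = D at h3 hsum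
    calc _ ≤ D * (ε / (2 * (D + 1))) := h3
      _ < (D + 1) * (ε / (2 * (D + 1))) := by gcongr; linarith
      _ = ε / 2 := by field_simp
  rw [hsplit]
  exact (norm_add_le _ _).trans_lt (by linarith)

variable [Group Γ]

/-- For `x, y ∈ L(Γ)` whose Fourier coefficients on `K` vanish, `‖E(x λ_h y)‖₂` is small as soon
as `a h b ∉ K` for all `a` and `b` in a suitable finite subset `A` of `Γ ∖ K`. -/
theorem exists_norm_restrict_lt {K : Subgroup Γ} {x : Ell2 Γ →L[ℂ] Ell2 Γ}
    (hx : x ∈ groupVN (⊤ : Subgroup Γ)) (hxK : ∀ k ∈ K, x (deltaOne Γ) k = 0)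
    {η : Ell2 Γ} (hη : ∀ k ∈ K, η k = 0) {ε : ℝ} (hε : 0 < ε) :
    ∃ A : Finset Γ, (∀ a ∈ A, a ∉ K) ∧ ∀ h, (∀ a ∈ A, ∀ b ∈ A, a * h * b ∉ K) →
      ‖restrict (K : Set Γ) (x (leftRegular h η))‖ < ε := by
  classical
  -- First `η` is approximated, relative to `‖x‖`; then `x δ_1`, relative to the values of `η` on `B`.
  obtain ⟨B, hB, hBε⟩ := exists_norm_sub_sum_smul_delta_lt η
    (show 0 < ε / (2 * (‖x‖ + 1)) by positivity)
  obtain ⟨A, hA, hAε⟩ := exists_norm_sub_sum_smul_delta_lt (x (deltaOne Γ))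
    (show 0 < ε / (2 * (∑ b ∈ B, ‖η b‖ + 1)) by positivity)
  refine ⟨A ∪ B, ?_, ?_⟩
  · intro a ha haK
    rcases Finset.mem_union.mp ha with ha | ha
    · exact hA a ha (hxK a haK)
    · exact hB a ha (hη a haK)
  intro h hAB
  refine norm_apply_lt_of_norm_apply_delta_le
    (T := restrict (K : Set Γ) ∘L x ∘L leftRegular h) (norm_nonneg x) ?_ hε hBε ?_
  · intro f
    refine (norm_restrict_le _ _).trans ((x.le_opNorm _).trans ?_)
    exact mul_le_mul_of_nonneg_left (norm_leftRegular h f).le (norm_nonneg x)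
  · intro b hb
    change ‖restrict (K : Set Γ) (x (leftRegular h (delta b)))‖ ≤ _
    -- The part of `x δ_{hb}` coming from `A` is supported in `A h b`, which is disjoint from `K`.
    have e : restrict (K : Set Γ) (x (leftRegular h (delta b))) = restrict (K : Set Γ)
        (rightRegular (h * b)⁻¹
          (x (deltaOne Γ) - ∑ a ∈ A, x (deltaOne Γ) a • delta a)) := by
      rw [leftRegular_delta, apply_delta hx, map_sub, map_sub, sub_eq_self.mpr]
      ext k
      by_cases hk : k ∈ (K : Set Γ)
      · rw [restrict_apply_of_mem hk, rightRegular_apply]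
        refine sum_smul_delta_apply_of_notMem fun hmem => ?_
        refine hAB _ (Finset.mem_union_left _ hmem) b (Finset.mem_union_right _ hb) ?_
        simpa [mul_assoc] using hk
      · rw [restrict_apply_of_notMem hk]
        rfl
    rw [e]
    refine (norm_restrict_le _ _).trans ?_
    rw [norm_rightRegular]
    exact hAε.le

/-- The unitary `λ_h` as an element of `L(Γ)`. -/
noncomputable def groupUnitary (h : Γ) : VNInclusion.Elem (groupVN (⊤ : Subgroup Γ)) :=
  ⟨leftRegular h, leftRegular_mem_groupVN (Subgroup.mem_top h)⟩

theorem groupUnitary_mem_unitary (h : Γ) :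
    groupUnitary h ∈ unitary (VNInclusion.Elem (groupVN (⊤ : Subgroup Γ))) := by
  have e : star (leftRegular h) = leftRegular h⁻¹ := star_leftRegular h
  refine Unitary.mem_iff.mpr ⟨Subtype.ext ?_, Subtype.ext ?_⟩
  · change star (leftRegular h) * leftRegular h = 1
    rw [e, leftRegular_mul, inv_mul_cancel, leftRegular_one]
  · change leftRegular h * star (leftRegular h) = 1
    rw [e, leftRegular_mul, mul_inv_cancel, leftRegular_one]

/-- Only the parts of `x` and `y` orthogonal to `L(K)` contribute to `E(x u y) - E(x) u E(y)`. -/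
theorem condExp_mul_mul_sub {K : Subgroup Γ} {u : VNInclusion.Elem (groupVN (⊤ : Subgroup Γ))}
    (hu : (u : Ell2 Γ →L[ℂ] Ell2 Γ) ∈ groupVN K)
    (x y : VNInclusion.Elem (groupVN (⊤ : Subgroup Γ))) :
    condExp K (x * u * y) - condExp K x * u * condExp K y =
      condExp K ((x - condExp K x) * u * (y - condExp K y)) := by
  have hE := isCondExp_condExp K
  have h1 : condExp K (condExp K x * u * y) = condExp K x * u * condExp K y := by
    have h := hE.bimodule (condExp K x * u) y 1 (mul_mem (hE.mem x) hu) (one_mem (groupVN K))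
    rwa [mul_one, mul_one] at h
  have h2 : condExp K (x * u * condExp K y) = condExp K x * u * condExp K y := by
    have h := hE.bimodule 1 x (u * condExp K y) (one_mem (groupVN K)) (mul_mem hu (hE.mem y))
    rwa [one_mul, one_mul, ← mul_assoc, ← mul_assoc] at h
  have h3 : condExp K (condExp K x * u * condExp K y) = condExp K x * u * condExp K y :=
    hE.eq_self _ (mul_mem (mul_mem (hE.mem x) hu) (hE.mem y))
  simp only [sub_mul, mul_sub, map_sub, h1, h2, h3, sub_self, sub_zero]

theorem apply_deltaOne_sub_condExp (K : Subgroup Γ)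
    (x : VNInclusion.Elem (groupVN (⊤ : Subgroup Γ))) {k : Γ} (hk : k ∈ K) :
    ((x - condExp K x : VNInclusion.Elem (groupVN (⊤ : Subgroup Γ))) : Ell2 Γ →L[ℂ] Ell2 Γ)
      (deltaOne Γ) k = 0 := by
  change (x : Ell2 Γ →L[ℂ] Ell2 Γ) (deltaOne Γ) k -
    (condExp K x : Ell2 Γ →L[ℂ] Ell2 Γ) (deltaOne Γ) k = 0
  rw [condExp_deltaOne, restrict_apply_of_mem hk, sub_self]

/-- The net is indexed by the finite subsets `A` of `Γ ∖ K`, with `u_A = λ_h` for an `h ∈ K` such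
that `a h b ∉ K` for all `a, b ∈ A`. -/
theorem exists_net_tendsto {K : Subgroup Γ}
    (hK : ∀ A : Finset Γ, (∀ a ∈ A, a ∉ K) → ∃ h ∈ K, ∀ a ∈ A, ∀ b ∈ A, a * h * b ∉ K) :
    ∃ (ι : Type u) (_ : Preorder ι) (_ : IsDirected ι (· ≤ ·)) (_ : Nonempty ι)
      (u : ι → VNInclusion.Elem (groupVN (⊤ : Subgroup Γ))),
      (∀ i, (u i : Ell2 Γ →L[ℂ] Ell2 Γ) ∈ groupVN K ∧
        u i ∈ unitary (VNInclusion.Elem (groupVN (⊤ : Subgroup Γ)))) ∧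
      ∀ x y : VNInclusion.Elem (groupVN (⊤ : Subgroup Γ)),
        Tendsto (fun i => VNInclusion.twoNorm (trace Γ)
          (condExp K (x * u i * y) - condExp K x * u i * condExp K y)) atTop (𝓝 0) := by
  classical
  have key : ∀ A : Finset {g : Γ // g ∉ K}, ∃ h ∈ K, ∀ a ∈ A, ∀ b ∈ A,
      (a : Γ) * h * b ∉ K := by
    intro A
    obtain ⟨h, hh, hA⟩ := hK (A.map (Function.Embedding.subtype _)) (by simp +contextual)
    exact ⟨h, hh, fun a ha b hb => hA a (Finset.mem_map_of_mem _ ha) b (Finset.mem_map_of_mem _ hb)⟩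
  choose h hhK hh using key
  refine ⟨Finset {g : Γ // g ∉ K}, inferInstance, inferInstance, inferInstance,
    fun A => groupUnitary (h A),
    fun A => ⟨leftRegular_mem_groupVN (hhK A), groupUnitary_mem_unitary _⟩, fun x y => ?_⟩
  refine Metric.tendsto_nhds.mpr fun ε hε => ?_
  obtain ⟨A, hAK, hA⟩ := exists_norm_restrict_lt (x - condExp K x).2
    (fun k hk => apply_deltaOne_sub_condExp K x hk) (fun k hk => apply_deltaOne_sub_condExp K y hk) hε
  refine eventually_atTop.mpr ⟨A.subtype (· ∉ K), fun A' hA' => ?_⟩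
  rw [condExp_mul_mul_sub (leftRegular_mem_groupVN (hhK A')), twoNorm_trace, condExp_deltaOne,
    dist_zero_right, norm_norm]
  refine hA (h A') fun a ha b hb => ?_
  exact hh A' ⟨a, hAK a ha⟩ (hA' (Finset.mem_subtype.mpr ha)) ⟨b, hAK b hb⟩
    (hA' (Finset.mem_subtype.mpr hb))

/-- Weak mixing is the case `E(x) = E(y) = 0` of the weak asymptotic homomorphism property, applied
to finitely many pairs `x, y` at once. -/
theorem weakAsymptoticHomomorphismProperty_and_weaklyMixing {K : Subgroup Γ}
    (hK : ∀ A : Finset Γ, (∀ a ∈ A, a ∉ K) → ∃ h ∈ K, ∀ a ∈ A, ∀ b ∈ A, a * h * b ∉ K) :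
    VNInclusion.WeakAsymptoticHomomorphismProperty (groupVN K) (groupVN (⊤ : Subgroup Γ))
        (trace Γ) ∧
      VNInclusion.WeaklyMixing (groupVN K) (groupVN (⊤ : Subgroup Γ)) (trace Γ) := by
  obtain ⟨ι, i₁, i₂, i₃, u, hu, hlim⟩ := exists_net_tendsto hK
  refine ⟨⟨condExp K, isCondExp_condExp K, ι, i₁, i₂, i₃, u, hu, hlim⟩,
    condExp K, isCondExp_condExp K, fun s hs ε hε => ?_⟩
  have hev : ∀ᶠ i in atTop, ∀ x ∈ s, ∀ y ∈ s,
      VNInclusion.twoNorm (trace Γ) (condExp K (x * u i * y)) < ε := by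
    refine (Finset.eventually_all s).mpr fun x hx => (Finset.eventually_all s).mpr fun y hy => ?_
    refine ((hlim x y).eventually_lt_const hε).mono fun i hi => ?_
    rwa [hs x hx, zero_mul, zero_mul, sub_zero] at hi
  obtain ⟨i, hi⟩ := hev.exists
  exact ⟨u i, (hu i).1, (hu i).2, hi⟩

end GroupVN

/-! ### The inclusion of the Higman–Thompson factor -/

theorem mainTheorem2 {d : ℕ} {G : ℕ → Type u} [∀ n, Group (G n)]
    (S : ThompsonLike.CloningSystem d G) (hS : S.IsDiverse) :
    VNInclusion.WeakAsymptoticHomomorphismProperty (GroupVN.groupVN S.higmanThompsonF)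
        (GroupVN.groupVN (⊤ : Subgroup S.Grp)) (GroupVN.trace S.Grp) ∧
      VNInclusion.WeaklyMixing (GroupVN.groupVN S.higmanThompsonF)
        (GroupVN.groupVN (⊤ : Subgroup S.Grp)) (GroupVN.trace S.Grp) ∧
      ∀ g : S.Grp, GroupVN.IsOneSidedQuasiNormalizer S.higmanThompsonF g →
        g ∈ S.higmanThompsonF := by
  have hc : ∀ g : S.Grp, GroupVN.IsOneSidedQuasiNormalizer S.higmanThompsonF g →
      g ∈ S.higmanThompsonF := fun g => S.mem_of_isOneSidedQuasiNormalizer hS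
  have hab := GroupVN.weakAsymptoticHomomorphismProperty_and_weaklyMixing
    (GroupVN.exists_forall_mul_mul_notMem hc)
  exact ⟨hab.1, hab.2, hc⟩
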